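/- All graphs are finite and simple. A cycle is a polygonal 2-tree, and if $H$ is a polygonal 2-tree and $(u,v)\in E(H)$, then adding a path $P$ between $u$ and $v$ with $|E(P)|\ge 2$, $E(P)\cap E(H)=\emptyset$ and $V(P)\cap V(H)=\{u,v\}$ gives a polygonal 2-tree; nothing else is a polygonal 2-tree. An edge of a graph is internal if it lies on at least two induced cycles, and external otherwise; an induced cycle is external if it has an external edge. Let $G$ be a polygonal 2-tree. For $A\subseteq E(G)$ let $\mathrm{bound}(A,G)$ be the set of external edges of $G-A$ that are not bridges of $G-A$. For $e\in\mathrm{bound}(A,G)$ let $G_e$ be the 2-connected component (maximal 2-connected subgraph) of $G-A$ containing $e$, and let $$\mathrm{Sup}_A(e)=\{(u,v)\in A:\ \text{there is a path } P \text{ joining } u,v \text{ in } G-A \text{ with } P\cap G_e=e\},\qquad \mathrm{cost}_A(e)=|\mathrm{Sup}_A(e)|,$$ where $P \cap G_e = e$ means that the intersection is the graph consisting of the edge $e$ and its two ends. Algorithm. Start with $A=\emptyset$ and $Q=\mathrm{bound}(\emptyset,G)$, and for every edge $q$ put $c[q]=0$, $pCycles[q]=\emptyset$, and $unpCount[q]=$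 the number of induced cycles of $G$ containing $q$. While $Q\ne\emptyset$: extract from $Q$ an edge $x$ with $c[x]$ minimum, add $x$ to $A$, let $C$ be the unique element of $Cycles[x]\setminus pCycles[x]$, where $Cycles[x]$ is the set of induced cycles of $G$ containing $x$; for each $q\in E(C)\setminus\{x\}$ replace $c[q]$ by $c[q]+c[x]+1$, add $C$ to $pCycles[q]$, decrease $unpCount[q]$ by one, and then insert $q$ into $Q$ if $unpCount[q]=1$ and delete $q$ from $Q$ if $unpCount[q]=0$. Consider any execution of this algorithm on $G$; let $A_j$ be the set $A$ after $j$ iterations and $x_j$ the edge extracted in iteration $j$. An induced cycle $C$ of $G-A_{t}$ containing $x_{t+1}$ is said to be processed in iteration $t+1$, and $x_{t+1}$ is called the destructive edge of $C$. Theorem. Suppose that $j$ iterations have been performed and let $e\in\mathrm{bound}(A_j,G)$ be an edge that is internal in $G$. Then there is a unique induced cycle $C$ of $G-A_j$ containing $e$, and it is external. Let $C_1,\dots,C_k$ be the distinct other induced cycles of $G$ containing $e$. Each $C_i$ has been processed in exactly one iteration $f(i)+1\le j$; let $e_i=x_{f(i)+1}$ be its destructive edge. Then $e_i\in\mathrm{bound}(A_{f(i)},G)$,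 the edges $e_1,\dots,e_k$ are distinct, and $$\mathrm{Sup}_{A_j}(e)=\mathrm{Sup}_{A_{f(1)}}(e_1)\uplus\dots\uplus\mathrm{Sup}_{A_{f(k)}}(e_k)\uplus\{e_1,\dots,e_k\},$$ a union of pairwise disjoint sets. Consequently $$\mathrm{cost}_{A_j}(e)=\sum_{i=1}^k\mathrm{cost}_{A_{f(i)}}(e_i)+k,$$ and after $j$ iterations the value stored by the algorithm is correct: $c[e]=\mathrm{cost}_{A_j}(e)$. -/

import Mathlib

open SimpleGraph

noncomputable section

namespace PolygonalTwoTree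

variable {V : Type*}

/-- The subgraphs of `G` obtained from a cycle by repeatedly attaching a path with at least two
edges to the two ends of an existing edge. -/
inductive IsPolygonalPart (G : SimpleGraph V) : G.Subgraph → Prop
  | cycle {u : V} (p : G.Walk u u) (hp : p.IsCycle) : IsPolygonalPart G p.toSubgraph
  | attach {H : G.Subgraph} (hH : IsPolygonalPart G H) {u v : V} (huv : H.Adj u v)
      (p : G.Walk u v) (hp : p.IsPath) (hlen : 2 ≤ p.length)
      (hE : Disjoint H.edgeSet p.toSubgraph.edgeSet)
      (hV : H.verts ∩ p.toSubgraph.verts = {u, v}) :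
      IsPolygonalPart G (H ⊔ p.toSubgraph)

/-- `G` is a polygonal 2-tree: the whole graph arises by the above construction. -/
def IsPolygonal2Tree (G : SimpleGraph V) : Prop := IsPolygonalPart G ⊤

/-- `C` is the edge set of an induced (chordless) cycle of `G`. Cycles are identified with
their edge sets throughout. -/
def IsInducedCycle (G : SimpleGraph V) (C : Set (Sym2 V)) : Prop :=
  ∃ (u : V) (p : G.Walk u u), p.IsCycle ∧ p.IsChordless ∧ p.edgeSet = C

/-- The set of induced cycles of `G` that contain the edge `e`. -/
def cyclesThrough (G : SimpleGraph V) (e : Sym2 V) : Set (Set (Sym2 V)) :=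
  {C | IsInducedCycle G C ∧ e ∈ C}

/-- An edge is internal if it lies on at least two induced cycles. -/
def IsInternalEdge (G : SimpleGraph V) (e : Sym2 V) : Prop :=
  e ∈ G.edgeSet ∧ ∃ C ∈ cyclesThrough G e, ∃ D ∈ cyclesThrough G e, C ≠ D

/-- An edge is external if it is not internal. -/
def IsExternalEdge (G : SimpleGraph V) (e : Sym2 V) : Prop :=
  e ∈ G.edgeSet ∧ ¬ IsInternalEdge G e

/-- An induced cycle is external if it has an external edge. -/
def IsExternalInducedCycle (G : SimpleGraph V) (C : Set (Sym2 V)) : Prop :=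
  IsInducedCycle G C ∧ ∃ e ∈ C, IsExternalEdge G e

/-- The external edges of `G - A` that are not bridges of `G - A`. -/
def bound (G : SimpleGraph V) (A : Set (Sym2 V)) : Set (Sym2 V) :=
  {e | IsExternalEdge (G.deleteEdges A) e ∧ ¬ (G.deleteEdges A).IsBridge e}

/-- A connected subgraph that stays connected when any one vertex is removed. -/
def IsTwoConnected {H : SimpleGraph V} (B : H.Subgraph) : Prop :=
  B.Connected ∧ ∀ v : V, (B.deleteVerts {v}).Preconnected

/-- A 2-connected component: a maximal 2-connected subgraph. -/
def IsTwoConnectedComponent {H : SimpleGraph V} (B : H.Subgraph) : Prop :=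
  Maximal (fun B' : H.Subgraph => IsTwoConnected B') B

/-- The support of `e` with respect to the set `A` of deleted edges: all `(u,v) ∈ A` such that
`G - A` has a path `P` joining `u` and `v` whose intersection with the 2-connected component
`B` of `G - A` containing `e` is the single edge `e` (with its two ends). -/
def Sup (G : SimpleGraph V) (A : Set (Sym2 V)) (e : Sym2 V) : Set (Sym2 V) :=
  {q | q ∈ A ∧ ∃ B : (G.deleteEdges A).Subgraph, IsTwoConnectedComponent B ∧ e ∈ B.edgeSet ∧
    ∃ (u v : V) (P : (G.deleteEdges A).Walk u v), s(u, v) = q ∧ P.IsPath ∧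
      (P.toSubgraph ⊓ B).edgeSet = {e} ∧ (P.toSubgraph ⊓ B).verts = {w | w ∈ e}}

/-- The cost of `e` with respect to `A`. -/
def cost (G : SimpleGraph V) (A : Set (Sym2 V)) (e : Sym2 V) : ℕ := (Sup G A e).ncard

/-- The data maintained by the algorithm: the set `A` of removed edges, the heap `Q` (its
elements; the key of an element `q` is `c q`), the values `c`, and, for each edge, the set of
processed induced cycles and the number of unprocessed induced cycles through it. -/
structure AlgState (V : Type*) where
  A : Set (Sym2 V)
  Q : Set (Sym2 V)
  c : Sym2 V → ℕ
  pCycles : Sym2 V → Set (Set (Sym2 V))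
  unpCount : Sym2 V → ℕ

/-- The initial state of the algorithm. -/
def AlgState.init (G : SimpleGraph V) : AlgState V where
  A := ∅
  Q := bound G ∅
  c := fun _ => 0
  pCycles := fun _ => ∅
  unpCount := fun e => (cyclesThrough G e).ncard

open Classical in
/-- The effect of one pass through the main loop, when `e` is extracted from the heap and `C` is
the unprocessed induced cycle through `e`. The updates of the edges of `C` other than `e` do not
interact with each other, so they are performed simultaneously. -/
def AlgState.update (s : AlgState V) (e : Sym2 V) (C : Set (Sym2 V)) : AlgState V where
  A := s.A ∪ {e}
  Q := ((s.Q \ {e}) ∪ {q | q ∈ C \ {e} ∧ s.unpCount q - 1 = 1}) \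
    {q | q ∈ C \ {e} ∧ s.unpCount q - 1 = 0}
  c := fun q => if q ∈ C \ {e} then s.c q + s.c e + 1 else s.c q
  pCycles := fun q => if q ∈ C \ {e} then s.pCycles q ∪ {C} else s.pCycles q
  unpCount := fun q => if q ∈ C \ {e} then s.unpCount q - 1 else s.unpCount q

/-- One iteration of the main loop leads from `s` to `s'` and extracts the edge `e`, which has
minimum key in the heap (ties are broken arbitrarily). -/
def AlgStep (G : SimpleGraph V) (s : AlgState V) (e : Sym2 V) (s' : AlgState V) : Prop :=
  e ∈ s.Q ∧ (∀ q ∈ s.Q, s.c e ≤ s.c q) ∧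
    ∃ C, cyclesThrough G e \ s.pCycles e = {C} ∧ s' = s.update e C

/-- `S 0, …, S j` are the states after the first `j` iterations of an execution of the algorithm
on `G`, and `x t` is the edge extracted in iteration `t + 1`, for `t < j`. -/
def IsAlgRun (G : SimpleGraph V) (j : ℕ) (S : ℕ → AlgState V) (x : ℕ → Sym2 V) : Prop :=
  S 0 = AlgState.init G ∧ ∀ t < j, AlgStep G (S t) (x t) (S (t + 1))

/-- `C` is processed in iteration `t + 1`, with destructive edge `x t`: it is an induced cycle
of the graph before that iteration and contains the edge removed in it. -/
def IsProcessedIn (G : SimpleGraph V) (S : ℕ → AlgState V) (x : ℕ → Sym2 V) (t : ℕ)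
    (C : Set (Sym2 V)) : Prop :=
  C ∈ cyclesThrough (G.deleteEdges (S t).A) (x t)

end PolygonalTwoTree

end

/-!
The theorem rests on two properties of a polygonal 2-tree `G` (`IsEdgeSeparated`): it is
two-connected, and distinct induced cycles through an edge `ab` lie in different components of
`G - {a, b}`. They are proved along the construction of `G`; when a path is attached, its inner
vertices have degree two, so the only new induced cycle is the path closed by the edge between its
ends. The rest uses no other information on `G`.

Deleting an edge that lies on a single induced cycle removes this cycle and creates no new induced
cycle (`isInducedCycle_deleteEdges_singleton_iff`). So the induced cycles of `G - A_t` are those of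
`G` that avoid `A_t`, the heap is `bound G A_t`, each iteration processes exactly one induced
cycle, and `c` satisfies the recursion of the theorem (`AlgState.Invariant`,
`IsEliminationRun.c_eq_sum`).

For the supports, let `C` be the only induced cycle of `G - A` through `e = ab`, and let `X` be the
complement of the component of `G - {a, b}` that contains the rest of `C` (`side G e C`). The
subgraph of `G - A` on `X` is connected, `e` is a bridge of it, and the two-connected component of
`e` in `G - A` meets `X` in `a` and `b` only. Hence a deleted edge belongs to the support of `e` if
and only if it lies in `X` and joins the two sides of this bridge: `Sup G A e`, together with `e`,
is a cut of `G` restricted to `X`. Since induced cycles generate all cycles modulo two, this cut is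
the only set that contains `e`, consists otherwise of deleted edges in `X`, and meets every induced
cycle in `X` in an even number of edges (`Sup_eq_of_even`).

It remains to see that `{e}` united with the cuts at the destructive edges `e_i` of the other
induced cycles `C_i` through `e` has this property (`IsEliminationRun.Sup_eq_iUnion`). The cut at
`e_i` lies across `e_i` from `C_i`, hence in the component of `G - {a, b}` that contains the rest
of `C_i`, apart from the ends of `e`. So these cuts are pairwise disjoint. The cycle `C_i` meets the
union in `e` and `e_i` only, and any other induced cycle in `X` meets at most one of the cuts, and
that one evenly by induction on the number of iterations.
-/

open SimpleGraph

noncomputable section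

namespace PolygonalTwoTree

variable {V : Type*}

/-! ### Reachability in a graph with some vertices isolated -/

/-- The graph `G` with all edges at vertices of `S` removed. The vertices of `S` are kept, as
isolated vertices, so that no subtypes are needed to speak of connectivity in `G - S`. -/
def avoid (G : SimpleGraph V) (S : Set V) : SimpleGraph V where
  Adj x y := G.Adj x y ∧ x ∉ S ∧ y ∉ S
  symm := ⟨fun _ _ h => ⟨h.1.symm, h.2.2, h.2.1⟩⟩
  loopless := ⟨fun _ h => h.1.ne rfl⟩

lemma avoid_mono {G G' : SimpleGraph V} {S S' : Set V} (hG : G ≤ G') (hS : S' ⊆ S) :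
    avoid G S ≤ avoid G' S' :=
  fun _ _ h => ⟨hG h.1, fun h' => h.2.1 (hS h'), fun h' => h.2.2 (hS h')⟩

lemma avoid_le (G : SimpleGraph V) (S : Set V) : avoid G S ≤ G := fun _ _ h => h.1

lemma reachable_map_of_adj {V' : Type*} {G : SimpleGraph V} {G' : SimpleGraph V'} (r : V → V')
    (h : ∀ x y, G.Adj x y → G'.Reachable (r x) (r y)) {x y : V} (hxy : G.Reachable x y) :
    G'.Reachable (r x) (r y) := by
  obtain ⟨p⟩ := hxy
  induction p with
  | nil => exact .refl _
  | cons hadj _ ih => exact (h _ _ hadj).trans ih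

lemma reachable_of_adj {G G' : SimpleGraph V} (h : ∀ x y, G.Adj x y → G'.Reachable x y)
    {x y : V} (hxy : G.Reachable x y) : G'.Reachable x y :=
  reachable_map_of_adj id h hxy

lemma reachable_invariant {G : SimpleGraph V} {U : Set V}
    (h : ∀ x y, G.Adj x y → x ∈ U → y ∈ U) {x y : V} (hxy : G.Reachable x y) (hx : x ∈ U) :
    y ∈ U := by
  obtain ⟨p⟩ := hxy
  induction p with
  | nil => exact hx
  | cons hadj _ ih => exact ih (h _ _ hadj hx)

lemma reachable_avoid_of_walk {G : SimpleGraph V} {S : Set V} {x y : V} (p : G.Walk x y)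
    (h : ∀ w ∈ p.support, w ∉ S) : (avoid G S).Reachable x y := by
  induction p with
  | nil => exact .refl _
  | cons hadj q ih =>
    rw [Walk.support_cons] at h
    refine Reachable.trans (Adj.reachable ⟨hadj, h _ (by simp), h _ (by simp)⟩)
      (ih fun w hw => h w (by simp [hw]))

lemma walk_avoid_support {G : SimpleGraph V} {S : Set V} {x y : V} (p : (avoid G S).Walk x y)
    (hx : x ∉ S) : ∀ w ∈ p.support, w ∉ S := by
  induction p with
  | nil => simpa using hx
  | cons hadj q ih =>
    intro w hw
    rw [Walk.support_cons, List.mem_cons] at hw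
    rcases hw with rfl | hw
    · exact hx
    · exact ih hadj.2.2 w hw

/-- Along a path, every vertex but the last is reachable from the first without using the last. -/
lemma reachable_avoid_of_isPath {G : SimpleGraph V} {S : Set V} {s t x : V} (p : G.Walk s t)
    (hp : p.IsPath) (hx : x ∈ p.support) (hxt : x ≠ t) (hS : ∀ w ∈ p.support, w ∈ S → w = t) :
    (avoid G S).Reachable s x := by
  classical
  refine reachable_avoid_of_walk (p.takeUntil x hx) fun w hw hwS => ?_
  have := hS w (p.support_takeUntil_subset_support hx hw) hwS
  subst this
  exact Walk.endpoint_notMem_support_takeUntil hp hx hxt.symm hw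

/-- Removing a vertex from a path leaves each other vertex connected to one of the two ends. -/
lemma reachable_end_of_isPath {G : SimpleGraph V} {s t x z : V} (p : G.Walk s t)
    (hp : p.IsPath) (hx : x ∈ p.support) (hxz : x ≠ z) :
    (s ≠ z ∧ (avoid G {z}).Reachable s x) ∨ (t ≠ z ∧ (avoid G {z}).Reachable t x) := by
  classical
  by_cases hz : z ∈ (p.takeUntil x hx).support
  · right
    have key : z ∉ (p.dropUntil x hx).support := by
      intro hz'
      have h := hp.support_nodup
      rw [← p.take_spec hx, Walk.support_append] at h
      have h2 := List.disjoint_of_nodup_append h hz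
      rw [Walk.mem_support_iff] at hz'
      rcases hz' with h3 | h3
      · exact hxz h3.symm
      · exact h2 h3
    refine ⟨fun h => key (h ▸ Walk.end_mem_support _),
      (reachable_avoid_of_walk (p.dropUntil x hx) ?_).symm⟩
    rintro w hw rfl
    exact key hw
  · left
    refine ⟨fun h => hz (h ▸ Walk.start_mem_support _), reachable_avoid_of_walk
      (p.takeUntil x hx) ?_⟩
    rintro w hw rfl
    exact hz hw

/-! ### Cycles -/

/-- A cycle stays connected when a vertex is removed. -/
lemma reachable_avoid_of_isCycle {G : SimpleGraph V} {u z x y : V} {p : G.Walk u u}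
    (hp : p.IsCycle) (hx : x ∈ p.support) (hy : y ∈ p.support) (hxz : x ≠ z) (hyz : y ≠ z) :
    (avoid G {z}).Reachable x y := by
  classical
  by_cases hz : z ∈ p.support
  · have hc := hp.rotate hz
    rw [← p.mem_support_rotate_iff z hz] at hx hy
    generalize p.rotate z hz = c at hc hx hy
    cases c with
    | nil => simp at hc
    | cons h q =>
      rw [Walk.cons_isCycle_iff] at hc
      simp only [Walk.support_cons, List.mem_cons, hxz, hyz, false_or] at hx hy
      have := fun {w} hw hwz => reachable_avoid_of_isPath (S := {z}) (x := w) q hc.1 hw hwz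
        (fun _ _ h => h)
      exact (this hx hxz).symm.trans (this hy hyz)
  · have h : ∀ w ∈ p.support, (avoid G {z}).Reachable u w := fun w hw =>
      reachable_avoid_of_walk (p.takeUntil w hw) fun w' hw' h' =>
        hz (h' ▸ p.support_takeUntil_subset_support hw hw')
    exact (h x hx).symm.trans (h y hy)

/-- A cycle stays connected when the two ends of one of its edges are removed. -/
lemma reachable_avoid_edge_of_isCycle {G : SimpleGraph V} {u x y : V} {e : Sym2 V} {p : G.Walk u u}
    (hp : p.IsCycle) (he : e ∈ p.edges) (hx : x ∈ p.support) (hy : y ∈ p.support) (hxe : x ∉ e)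
    (hye : y ∉ e) : (avoid G {w | w ∈ e}).Reachable x y := by
  classical
  induction e with
  | _ a b =>
  have ha := p.fst_mem_support_of_mem_edges he
  have hc := hp.rotate ha
  have hab : (p.rotate a ha).toSubgraph.Adj a b := by
    rw [Walk.toSubgraph_rotate]
    exact Walk.adj_toSubgraph_iff_mem_edges.2 he
  obtain ⟨c, hc, hcb, hcs⟩ := hc.exists_isCycle_snd_verts_eq hab
  have hs : ∀ w, w ∈ p.support → w ∈ c.support := fun w hw => by
    rw [← Walk.mem_verts_toSubgraph, hcs, Walk.mem_verts_toSubgraph]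
    simpa using hw
  replace hx := hs x hx
  replace hy := hs y hy
  simp only [Sym2.mem_iff, not_or] at hxe hye
  cases c with
  | nil => simp at hc
  | cons h q =>
    rw [Walk.cons_isCycle_iff] at hc
    simp only [Walk.support_cons, List.mem_cons, hxe.1, hye.1, false_or] at hx hy
    simp only [Walk.snd_cons] at hcb
    subst hcb
    cases q with
    | nil => exact absurd rfl h.ne
    | cons h' q' =>
      simp only [Walk.support_cons, List.mem_cons, hxe.2, hye.2, false_or] at hx hy
      have hq := (Walk.cons_isPath_iff _ _).1 hc.1
      have := fun {w} hw hwz => reachable_avoid_of_isPath (S := {w | w ∈ s(a, _)}) (x := w) q'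
        hq.1 hw hwz (fun w hw h => by
          rcases Sym2.mem_iff.1 h with h | h
          · exact h
          · subst h
            exact absurd hw hq.2)
      exact (this hx hxe.1).symm.trans (this hy hye.1)

/-- A chord `xy` splits a cycle into two paths between `x` and `y`, each of which closes up with
the chord to a cycle. -/
lemma exists_split_of_isCycle {G : SimpleGraph V} {u x y : V} {p : G.Walk u u}
    (hp : p.IsCycle) (hx : x ∈ p.support) (hy : y ∈ p.support) (hxy : G.Adj x y)
    (hne : s(x, y) ∉ p.edges) :
    ∃ (P : G.Walk x y) (Q : G.Walk y x), (Walk.cons hxy.symm P).IsCycle ∧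
      (Walk.cons hxy Q).IsCycle ∧ 2 ≤ P.length ∧ 2 ≤ Q.length ∧
      P.length + Q.length = p.length ∧ (P.edges ++ Q.edges).Perm p.edges ∧
      (∀ w, w ∈ p.support ↔ w ∈ P.support ∨ w ∈ Q.support) ∧
      ∀ w, w ∈ P.support → w ∈ Q.support → w = x ∨ w = y := by
  classical
  have hc := hp.rotate hx
  have hs : ∀ w, w ∈ (p.rotate x hx).support ↔ w ∈ p.support :=
    fun w => p.mem_support_rotate_iff x hx
  have hE := (p.rotate_edges x hx).perm
  have hl := p.length_rotate x hx
  generalize p.rotate x hx = c at hc hs hE hl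
  have hyc := (hs y).2 hy
  have hspec := c.take_spec hyc
  have hP : (c.takeUntil y hyc).IsPath := hc.isPath_takeUntil hyc
  have hQ : (c.dropUntil y hyc).IsPath := by
    rw [← hspec] at hc
    exact hc.isPath_of_append_right (Walk.not_nil_of_ne hxy.ne)
  generalize c.takeUntil y hyc = P at *
  generalize c.dropUntil y hyc = Q at *
  subst hspec
  have hPQ : (P.edges ++ Q.edges).Perm p.edges := by rwa [← Walk.edges_append]
  have hPe : s(x, y) ∉ P.edges := fun h => hne (hPQ.subset (List.mem_append_left _ h))
  have hQe : s(x, y) ∉ Q.edges := fun h => hne (hPQ.subset (List.mem_append_right _ h))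
  have h1 : (Walk.cons hxy.symm P).IsCycle :=
    (Walk.cons_isCycle_iff _ _).2 ⟨hP, by rwa [Sym2.eq_swap]⟩
  have h2 : (Walk.cons hxy Q).IsCycle := (Walk.cons_isCycle_iff _ _).2 ⟨hQ, hQe⟩
  refine ⟨P, Q, h1, h2, ?_, ?_, ?_, hPQ, ?_, ?_⟩
  · have := h1.three_le_length
    simpa using this
  · have := h2.three_le_length
    simpa using this
  · rw [← hl, Walk.length_append]
  · intro w
    rw [← hs, Walk.mem_support_append_iff]
  · intro w hwP hwQ
    by_contra! hw
    have hnd := hc.support_nodup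
    rw [Walk.tail_support_append] at hnd
    rw [Walk.mem_support_iff] at hwP hwQ
    exact List.disjoint_of_nodup_append hnd (hwP.resolve_left hw.1) (hwQ.resolve_left hw.2)

/-- The vertices incident with a set of edges. -/
def verts (F : Set (Sym2 V)) : Set V := {w | ∃ e ∈ F, w ∈ e}

lemma verts_mono {F F' : Set (Sym2 V)} (h : F ⊆ F') : verts F ⊆ verts F' :=
  fun _ ⟨e, he, hw⟩ => ⟨e, h he, hw⟩

lemma mem_verts_edgeSet {G : SimpleGraph V} {u w : V} {p : G.Walk u u} (hp : p.IsCycle) :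
    w ∈ verts p.edgeSet ↔ w ∈ p.support := by
  rw [Walk.mem_support_iff_exists_mem_edges_of_not_nil hp.not_nil]
  rfl

lemma IsInducedCycle.subset_edgeSet {G : SimpleGraph V} {F : Set (Sym2 V)}
    (hF : IsInducedCycle G F) : F ⊆ G.edgeSet := by
  obtain ⟨u, p, -, -, rfl⟩ := hF
  exact fun e he => p.edges_subset_edgeSet he

lemma exists_ne_mem_edges_of_isCycle {G : SimpleGraph V} {u : V} {p : G.Walk u u}
    (hp : p.IsCycle) (e : Sym2 V) : ∃ e' ∈ p.edges, e' ≠ e := by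
  by_contra! h
  have h1 := hp.three_le_length
  have h2 := hp.isTrail.edges_nodup
  rw [← Walk.length_edges] at h1
  match hl : p.edges with
  | [] => simp [hl] at h1
  | [_] => simp [hl] at h1
  | a :: b :: l =>
    rw [hl] at h h2
    have ha := h a (by simp)
    have hb := h b (by simp)
    simp [ha, hb] at h2

lemma exists_mem_notMem_of_ne {G : SimpleGraph V} {q e : Sym2 V} (hq : q ∈ G.edgeSet)
    (hne : q ≠ e) : ∃ w ∈ q, w ∉ e := by
  by_contra! h
  induction q with
  | _ a b =>
    exact hne ((Sym2.mem_and_mem_iff (show G.Adj a b from hq).ne).1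
      ⟨h a (Sym2.mem_mk_left a b), h b (Sym2.mem_mk_right a b)⟩).symm

/-- A cycle has a vertex besides the two ends of a given edge. -/
lemma IsInducedCycle.exists_vert_notMem {G : SimpleGraph V} {F : Set (Sym2 V)}
    (hF : IsInducedCycle G F) (e : Sym2 V) : ∃ w ∈ verts F, w ∉ e := by
  obtain ⟨u, p, hp, -, rfl⟩ := hF
  obtain ⟨e', he', hne⟩ := exists_ne_mem_edges_of_isCycle hp e
  obtain ⟨w, hw, hwe⟩ := exists_mem_notMem_of_ne (p.edges_subset_edgeSet he') hne
  exact ⟨w, ⟨e', he', hw⟩, hwe⟩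

/-- Cutting along chords, a cycle through `e` contains the vertices of an induced cycle
through `e`. -/
lemma exists_inducedCycle_of_isCycle {G : SimpleGraph V} {u : V} {e : Sym2 V} {p : G.Walk u u}
    (hp : p.IsCycle) (he : e ∈ p.edges) :
    ∃ F ∈ cyclesThrough G e, verts F ⊆ {w | w ∈ p.support} := by
  induction hn : p.length using Nat.strong_induction_on generalizing u with
  | _ n ih =>
  by_cases hch : p.IsChordless
  · exact ⟨p.edgeSet, ⟨⟨u, p, hp, hch, rfl⟩, he⟩, fun w hw => (mem_verts_edgeSet hp).1 hw⟩
  · rw [Walk.isChordless_iff_forall_mem_edges] at hch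
    push Not at hch
    obtain ⟨x, y, hx, hy, hxy, hne⟩ := hch
    obtain ⟨P, Q, h1, h2, hP, hQ, hl, hE, hs, -⟩ := exists_split_of_isCycle hp hx hy hxy hne
    have hsx : x ∈ P.support := P.start_mem_support
    have hsy : y ∈ P.support := P.end_mem_support
    rcases List.mem_append.1 (hE.symm.subset he) with h | h
    · obtain ⟨F, hF, hFs⟩ := ih _ (by rw [Walk.length_cons]; lia) h1
        (by rw [Walk.edges_cons]; exact List.mem_cons_of_mem _ h) rfl
      refine ⟨F, hF, fun w hw => (hs w).2 ?_⟩
      have := hFs hw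
      simp only [Walk.support_cons, Set.mem_ofPred_eq, List.mem_cons] at this
      rcases this with rfl | h
      · exact .inl hsy
      · exact .inl h
    · obtain ⟨F, hF, hFs⟩ := ih _ (by rw [Walk.length_cons]; lia) h2
        (by rw [Walk.edges_cons]; exact List.mem_cons_of_mem _ h) rfl
      refine ⟨F, hF, fun w hw => (hs w).2 ?_⟩
      have := hFs hw
      simp only [Walk.support_cons, Set.mem_ofPred_eq, List.mem_cons] at this
      rcases this with rfl | h
      · exact .inl hsx
      · exact .inr h

open Classical in
lemma ncard_edgeSet_inter {G : SimpleGraph V} {u : V} {p : G.Walk u u} (hp : p.IsCycle)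
    (K : Set (Sym2 V)) : (p.edgeSet ∩ K).ncard = p.edges.countP (· ∈ K) := by
  have : p.edgeSet ∩ K = ((p.edges.filter (· ∈ K)).toFinset : Set (Sym2 V)) := by
    ext e
    simp [Walk.edgeSet]
  rw [this, Set.ncard_coe_finset, List.toFinset_card_of_nodup
    (hp.isTrail.edges_nodup.filter _), List.countP_eq_length_filter]

/-- A cycle is a sum modulo two of induced cycles on its vertices: an edge set that meets
the latter evenly meets the cycle evenly. -/
lemma even_ncard_inter_of_isCycle {G : SimpleGraph V} {K : Set (Sym2 V)} {U : Set V}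
    (hK : ∀ F, IsInducedCycle G F → verts F ⊆ U → Even (F ∩ K).ncard) {u : V} {p : G.Walk u u}
    (hp : p.IsCycle) (hU : ∀ w ∈ p.support, w ∈ U) : Even (p.edgeSet ∩ K).ncard := by
  classical
  induction hn : p.length using Nat.strong_induction_on generalizing u with
  | _ n ih =>
  by_cases hch : p.IsChordless
  · exact hK _ ⟨u, p, hp, hch, rfl⟩ fun w hw => hU w ((mem_verts_edgeSet hp).1 hw)
  · rw [Walk.isChordless_iff_forall_mem_edges] at hch
    push Not at hch
    obtain ⟨x, y, hx, hy, hxy, hne⟩ := hch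
    obtain ⟨P, Q, h1, h2, hP, hQ, hl, hE, hs, -⟩ := exists_split_of_isCycle hp hx hy hxy hne
    have e1 := ih _ (by rw [Walk.length_cons]; lia) h1 (fun w hw => by
      rw [Walk.support_cons, List.mem_cons] at hw
      rcases hw with rfl | hw
      · exact hU _ hy
      · exact hU w ((hs w).2 (.inl hw))) rfl
    have e2 := ih _ (by rw [Walk.length_cons]; lia) h2 (fun w hw => by
      rw [Walk.support_cons, List.mem_cons] at hw
      rcases hw with rfl | hw
      · exact hU _ hx
      · exact hU w ((hs w).2 (.inr hw))) rfl
    rw [ncard_edgeSet_inter h1, Walk.edges_cons, List.countP_cons, Sym2.eq_swap] at e1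
    rw [ncard_edgeSet_inter h2, Walk.edges_cons, List.countP_cons] at e2
    rw [ncard_edgeSet_inter hp, ← hE.countP_eq, List.countP_append]
    generalize (if decide (s(x, y) ∈ K) = true then 1 else 0) = d at e1 e2
    rw [Nat.even_iff] at *
    lia

/-- A cycle that is contained in another cycle is equal to it. -/
lemma edgeSet_eq_of_isCycle_of_subset {G : SimpleGraph V} {u v : V} {p : G.Walk u u}
    {q : G.Walk v v} (hp : p.IsCycle) (hq : q.IsCycle) (h : p.edgeSet ⊆ q.edgeSet) :
    p.edgeSet = q.edgeSet := by
  have hadj : ∀ x y, p.toSubgraph.Adj x y → q.toSubgraph.Adj x y := fun x y hxy =>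
    Walk.adj_toSubgraph_iff_mem_edges.2 (h (Walk.adj_toSubgraph_iff_mem_edges.1 hxy))
  have hsup : ∀ x ∈ p.support, x ∈ q.support := fun x hx =>
    (mem_verts_edgeSet hq).1 (verts_mono h ((mem_verts_edgeSet hp).2 hx))
  -- both cycles have two edges at each vertex, so they agree at the vertices of `p`
  have key : ∀ x ∈ p.support, ∀ y, q.toSubgraph.Adj x y → p.toSubgraph.Adj x y := by
    intro x hx y hxy
    have h2 : p.toSubgraph.neighborSet x = q.toSubgraph.neighborSet x :=
      Set.eq_of_subset_of_ncard_le (fun y hy => hadj x y hy)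
        (by rw [hq.ncard_neighborSet_toSubgraph_eq_two (hsup x hx),
          hp.ncard_neighborSet_toSubgraph_eq_two hx])
        q.finite_neighborSet_toSubgraph
    have : y ∈ q.toSubgraph.neighborSet x := hxy
    rwa [← h2] at this
  have hall : ∀ x ∈ q.support, x ∈ p.support := by
    intro x hx
    have hu : u ∈ q.toSubgraph.verts := q.mem_verts_toSubgraph.2 (hsup u p.start_mem_support)
    obtain ⟨w⟩ := q.toSubgraph_connected.preconnected ⟨u, hu⟩ ⟨x, q.mem_verts_toSubgraph.2 hx⟩
    refine reachable_invariant (G := q.toSubgraph.spanningCoe) (U := {x | x ∈ p.support}) ?_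
      (reachable_map_of_adj (G := q.toSubgraph.coe) (fun x => x.1) (fun a b hab => Adj.reachable hab)
        ⟨w⟩) p.start_mem_support
    intro a b hab ha
    exact Walk.mem_support_of_adj_toSubgraph (key a ha b hab).symm
  refine h.antisymm fun e he => ?_
  induction e with
  | _ a b =>
    have hq' := Walk.adj_toSubgraph_iff_mem_edges.2 he
    exact Walk.adj_toSubgraph_iff_mem_edges.1
      (key a (hall a (Walk.mem_support_of_adj_toSubgraph hq')) b hq')

/-! ### Induced cycles -/

/-- Deleting an edge that lies on at most one induced cycle destroys the induced cycles through
this edge and creates no new ones: if the deleted edge were a chord of an induced cycle of the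
smaller graph, it would lie on two induced cycles, one on each side of the chord. -/
lemma isInducedCycle_deleteEdges_singleton_iff {H : SimpleGraph V} {e : Sym2 V}
    (he : ∀ F ∈ cyclesThrough H e, ∀ F' ∈ cyclesThrough H e, F = F') (F : Set (Sym2 V)) :
    IsInducedCycle (H.deleteEdges {e}) F ↔ IsInducedCycle H F ∧ e ∉ F := by
  constructor
  · rintro ⟨u, p, hp, hch, rfl⟩
    have hle : H.deleteEdges {e} ≤ H := deleteEdges_le _
    have hsub : ∀ e' ∈ p.edges, e' ∈ H.edgeSet :=
      fun e' he' => edgeSet_mono hle (p.edges_subset_edgeSet he')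
    have hep : e ∉ p.edges := fun h => by
      have := p.edges_subset_edgeSet h
      simp [edgeSet_deleteEdges] at this
    refine ⟨⟨u, p.transfer H hsub, hp.transfer hsub, ?_, by simp⟩, hep⟩
    rw [Walk.isChordless_iff_forall_mem_edges]
    intro x y hx hy hxy
    rw [Walk.support_transfer] at hx hy
    rw [Walk.edges_transfer]
    by_cases hxe : s(x, y) = e
    · exfalso
      obtain ⟨P, Q, h1, h2, -, -, -, -, -, hPQ⟩ := exists_split_of_isCycle (hp.transfer hsub)
        (by simpa using hx) (by simpa using hy) hxy (by simpa [hxe] using hep)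
      obtain ⟨F, hF, hFs⟩ := exists_inducedCycle_of_isCycle (e := e) h1
        (by simp [← hxe, Sym2.eq_swap])
      obtain ⟨F', hF', hFs'⟩ := exists_inducedCycle_of_isCycle (e := e) h2 (by simp [← hxe])
      obtain rfl := he F hF F' hF'
      obtain ⟨w, hw, hwe⟩ := hF.1.exists_vert_notMem e
      have a1 := hFs hw
      have a2 := hFs' hw
      simp only [← hxe, Sym2.mem_iff, not_or] at hwe
      simp only [Walk.support_cons, Set.mem_ofPred_eq, List.mem_cons, hwe.1, hwe.2,
        false_or] at a1 a2
      exact (hPQ w a1 a2).elim hwe.1 hwe.2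
    · exact hch.mem_edges hx hy ((deleteEdges_adj).2 ⟨hxy, hxe⟩)
  · rintro ⟨⟨u, p, hp, hch, rfl⟩, hep⟩
    have hsub : ∀ e' ∈ p.edges, e' ∈ (H.deleteEdges {e}).edgeSet := fun e' he' => by
      rw [edgeSet_deleteEdges]
      exact ⟨p.edges_subset_edgeSet he', fun h => hep (Set.mem_singleton_iff.1 h ▸ he')⟩
    refine ⟨u, p.transfer _ hsub, hp.transfer hsub, ?_, by simp⟩
    rw [Walk.isChordless_iff_forall_mem_edges]
    intro x y hx hy hxy
    rw [Walk.support_transfer] at hx hy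
    rw [Walk.edges_transfer]
    exact hch.mem_edges hx hy hxy.1

/-- An induced cycle stays connected when the two ends of any edge of the graph are removed. -/
lemma IsInducedCycle.reachable_avoid_edge {G : SimpleGraph V} {F : Set (Sym2 V)} {e : Sym2 V}
    {x y : V} (hF : IsInducedCycle G F) (he : e ∈ G.edgeSet) (hx : x ∈ verts F)
    (hy : y ∈ verts F) (hxe : x ∉ e) (hye : y ∉ e) :
    (avoid G {w | w ∈ e}).Reachable x y := by
  obtain ⟨u, p, hp, hch, rfl⟩ := hF
  rw [mem_verts_edgeSet hp] at hx hy
  -- if the end `a` is not on the cycle, only the vertex `b` is removed from it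
  have key : ∀ a b, a ∉ p.support → x ≠ b → y ≠ b →
      (avoid G {w | w ∈ s(a, b)}).Reachable x y := by
    intro a b ha hxb hyb
    have hsub : ∀ e' ∈ p.edges, e' ∈ (avoid G {a}).edgeSet := by
      intro e' he'
      induction e' with
      | _ c d =>
        refine ⟨p.adj_of_mem_edges he', ?_, ?_⟩
        · rintro rfl
          exact ha (p.fst_mem_support_of_mem_edges he')
        · rintro rfl
          exact ha (p.snd_mem_support_of_mem_edges he')
    refine (reachable_avoid_of_isCycle (z := b) (hp.transfer hsub) (x := x) (y := y) (by simpa)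
      (by simpa) hxb hyb).mono ?_
    intro c d h
    refine ⟨h.1.1, fun h' => ?_, fun h' => ?_⟩
    · rcases Sym2.mem_iff.1 h' with h' | h'
      · exact h.1.2.1 h'
      · exact h.2.1 h'
    · rcases Sym2.mem_iff.1 h' with h' | h'
      · exact h.1.2.2 h'
      · exact h.2.2 h'
  induction e with
  | _ a b =>
  simp only [Sym2.mem_iff, not_or] at hxe hye
  by_cases ha : a ∈ p.support
  · by_cases hb : b ∈ p.support
    · exact reachable_avoid_edge_of_isCycle hp (hch.mem_edges ha hb he) hx hy (by simpa using hxe)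
        (by simpa using hye)
    · rw [Sym2.eq_swap]
      exact key b a hb hxe.1 hye.1
  · exact key a b ha hxe.2 hye.2

/-! ### The structure of polygonal 2-trees -/

/-- The two properties of polygonal 2-trees on which everything else rests, for a graph `H` with
vertex set `U` (all other vertices being isolated): `H` stays connected when a vertex is removed,
and distinct induced cycles through an edge `ab` are separated from each other by `{a, b}`. -/
structure IsEdgeSeparated (H : SimpleGraph V) (U : Set V) : Prop where
  mem_of_adj : ∀ x y, H.Adj x y → x ∈ U
  reachable : ∀ z x y, x ∈ U → y ∈ U → x ≠ z → y ≠ z → (avoid H {z}).Reachable x y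
  eq_of_reachable : ∀ e, ∀ F ∈ cyclesThrough H e, ∀ F' ∈ cyclesThrough H e,
    ∀ w ∈ verts F, ∀ w' ∈ verts F', w ∉ e → w' ∉ e →
      (avoid H {x | x ∈ e}).Reachable w w' → F = F'

lemma IsEdgeSeparated.of_isCycle {H : SimpleGraph V} {u : V} {p : H.Walk u u} (hp : p.IsCycle)
    (hH : H.edgeSet ⊆ p.edgeSet) : IsEdgeSeparated H {w | w ∈ p.support} where
  mem_of_adj x y hxy :=
    p.fst_mem_support_of_mem_edges (hH (show s(x, y) ∈ H.edgeSet from hxy))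
  reachable z x y hx hy hxz hyz := reachable_avoid_of_isCycle hp hx hy hxz hyz
  eq_of_reachable e F hF F' hF' _ _ _ _ _ _ _ := by
    have key : ∀ F, IsInducedCycle H F → F = p.edgeSet := by
      rintro _ ⟨v, c, hc, -, rfl⟩
      exact edgeSet_eq_of_isCycle_of_subset hc hp fun e he => hH (c.edges_subset_edgeSet he)
    rw [key F hF.1, key F' hF'.1]

section Attach

variable {H H' : SimpleGraph V} {U : Set V} {u v : V} {p : H'.Walk u v}

/-- A cycle that contains an inner vertex of an attached path contains the whole path, because
the inner vertices of the path have degree two. -/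
lemma edgeSet_subset_of_isCycle_of_attach (hH : ∀ x y, H.Adj x y → x ∈ U) (huv : H.Adj u v)
    (hp : p.IsPath) (hadj : ∀ x y, H'.Adj x y → H.Adj x y ∨ s(x, y) ∈ p.edges)
    (hE : ∀ e ∈ p.edges, e ∉ H.edgeSet) (hV : ∀ w ∈ p.support, w ∈ U → w = u ∨ w = v)
    {r : V} {c : H'.Walk r r} (hc : c.IsCycle) {w : V} (hw : w ∈ c.support) (hwU : w ∉ U) :
    p.edgeSet ⊆ c.edgeSet := by
  have huU := hH u v huv
  have hvU := hH v u huv.symm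
  have hinner : ∀ i, i ≠ 0 → i < p.length → p.getVert i ∉ U := by
    intro i h0 hi h
    rcases hV _ (p.getVert_mem_support i) h with h | h
    · exact h0 ((hp.getVert_eq_start_iff hi.le).1 h)
    · exact hi.ne ((hp.getVert_eq_end_iff hi.le).1 h)
  have hindex : ∀ x, x ∉ U → x ∈ p.support → ∃ i, i ≠ 0 ∧ i < p.length ∧ p.getVert i = x := by
    intro x hx hxp
    obtain ⟨i, rfl, hi⟩ := Walk.mem_support_iff_exists_getVert.1 hxp
    refine ⟨i, ?_, lt_of_le_of_ne hi ?_, rfl⟩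
    · rintro rfl
      exact hx (by simpa using huU)
    · rintro rfl
      exact hx (by simpa using hvU)
  have hnb : ∀ x, x ∉ U → ∀ y, H'.Adj x y → s(x, y) ∈ p.edges := fun x hx y hxy =>
    (hadj x y hxy).resolve_left fun h => hx (hH x y h)
  have hedge : ∀ i, i ≠ 0 → i < p.length → p.getVert i ∈ c.support → ∀ y,
      s(p.getVert i, y) ∈ p.edges → s(p.getVert i, y) ∈ c.edges := by
    intro i h0 hi hic y hy
    have h2 : c.toSubgraph.neighborSet (p.getVert i) = p.toSubgraph.neighborSet (p.getVert i) :=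
      Set.eq_of_subset_of_ncard_le (fun y hy => Walk.adj_toSubgraph_iff_mem_edges.2
          (hnb _ (hinner i h0 hi) y (Subgraph.adj_sub _ hy)))
        (by rw [hc.ncard_neighborSet_toSubgraph_eq_two hic,
          hp.ncard_neighborSet_toSubgraph_internal_eq_two h0 hi])
        p.finite_neighborSet_toSubgraph
    have : y ∈ p.toSubgraph.neighborSet (p.getVert i) := Walk.adj_toSubgraph_iff_mem_edges.2 hy
    rw [← h2] at this
    exact Walk.adj_toSubgraph_iff_mem_edges.1 this
  have hconsec : ∀ i, i < p.length → s(p.getVert i, p.getVert (i + 1)) ∈ p.edges := fun i hi =>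
    Walk.adj_toSubgraph_iff_mem_edges.1 (p.toSubgraph_adj_getVert hi)
  obtain ⟨i, h0, hi, rfl⟩ : ∃ i, i ≠ 0 ∧ i < p.length ∧ p.getVert i = w := by
    obtain ⟨e, he, hwe⟩ := (mem_verts_edgeSet hc).2 hw
    obtain ⟨y, rfl⟩ := hwe
    exact hindex w hwU (p.fst_mem_support_of_mem_edges (hnb w hwU y (c.adj_of_mem_edges he)))
  have hup : ∀ k, i + k < p.length → p.getVert (i + k) ∈ c.support := by
    intro k
    induction k with
    | zero => exact fun _ => hw
    | succ k ih =>
      intro hk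
      exact c.snd_mem_support_of_mem_edges
        (hedge (i + k) (by lia) (by lia) (ih (by lia)) _ (hconsec (i + k) (by lia)))
  have hdown : ∀ k, k < i → p.getVert (i - k) ∈ c.support := by
    intro k
    induction k with
    | zero => exact fun _ => hw
    | succ k ih =>
      intro hk
      have h1 := hconsec (i - (k + 1)) (by lia)
      rw [show i - (k + 1) + 1 = i - k by lia, Sym2.eq_swap] at h1
      exact c.snd_mem_support_of_mem_edges (hedge (i - k) (by lia) (by lia) (ih (by lia)) _ h1)
  have hall : ∀ x, x ∉ U → x ∈ p.support → ∀ y, s(x, y) ∈ p.edges → s(x, y) ∈ c.edges := by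
    intro x hx hxp y hy
    obtain ⟨m, hm0, hm, rfl⟩ := hindex x hx hxp
    refine hedge m hm0 hm ?_ y hy
    rcases le_total i m with h | h
    · obtain ⟨k, rfl⟩ := Nat.exists_eq_add_of_le h
      exact hup k hm
    · have := hdown (i - m) (by lia)
      rwa [show i - (i - m) = m by lia] at this
  intro e he
  induction e with
  | _ x y =>
    by_cases hx : x ∈ U
    · by_cases hy : y ∈ U
      · exfalso
        have hxy := (p.adj_of_mem_edges he).ne
        refine hE _ he ?_
        rcases hV x (p.fst_mem_support_of_mem_edges he) hx with rfl | rfl <;>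
          rcases hV y (p.snd_mem_support_of_mem_edges he) hy with rfl | rfl
        · exact absurd rfl hxy
        · exact huv
        · exact huv.symm
        · exact absurd rfl hxy
      · have := hall y hy (p.snd_mem_support_of_mem_edges he) x (by rwa [Sym2.eq_swap])
        rwa [Sym2.eq_swap] at this
    · exact hall x hx (p.fst_mem_support_of_mem_edges he) y he

lemma IsEdgeSeparated.attach (hH : IsEdgeSeparated H U) (huv : H.Adj u v) (hp : p.IsPath)
    (hle : H ≤ H') (hadj : ∀ x y, H'.Adj x y → H.Adj x y ∨ s(x, y) ∈ p.edges)
    (hE : ∀ e ∈ p.edges, e ∉ H.edgeSet) (hV : ∀ w ∈ p.support, w ∈ U → w = u ∨ w = v) :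
    IsEdgeSeparated H' (U ∪ {w | w ∈ p.support}) := by
  classical
  have huU := hH.mem_of_adj u v huv
  have hvU := hH.mem_of_adj v u huv.symm
  have hd : (Walk.cons (hle huv.symm) p).IsCycle :=
    (Walk.cons_isCycle_iff _ _).2 ⟨hp, fun h => hE _ h huv.symm⟩
  have hnb : ∀ x, x ∉ U → ∀ y, H'.Adj x y → s(x, y) ∈ p.edges := fun x hx y hxy =>
    (hadj x y hxy).resolve_left fun h => hx (hH.mem_of_adj x y h)
  -- the only new induced cycle is the path closed by the edge between its ends
  have hnew : ∀ F, IsInducedCycle H' F → ∀ w ∈ verts F, w ∉ U →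
      F = (Walk.cons (hle huv.symm) p).edgeSet := by
    rintro _ ⟨r, c, hc, hch, rfl⟩ w hw hwU
    rw [mem_verts_edgeSet hc] at hw
    have hsub := edgeSet_subset_of_isCycle_of_attach hH.mem_of_adj huv hp hadj hE hV hc hw hwU
    have hpc : ∀ x ∈ p.support, x ∈ c.support := fun x hx => by
      rw [Walk.mem_support_iff_exists_mem_edges_of_not_nil (Walk.not_nil_of_ne huv.ne)] at hx
      exact (mem_verts_edgeSet hc).1 (verts_mono hsub hx)
    refine (edgeSet_eq_of_isCycle_of_subset hd hc fun e he => ?_).symm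
    rcases List.mem_cons.1 (show e ∈ s(v, u) :: p.edges from he) with rfl | he
    · exact hch.mem_edges (hpc _ p.end_mem_support) (hpc _ p.start_mem_support) (hle huv.symm)
    · exact hsub he
  have hold : ∀ F, IsInducedCycle H' F → (∀ w ∈ verts F, w ∈ U) → IsInducedCycle H F := by
    rintro _ ⟨r, c, hc, hch, rfl⟩ hU
    have hsub : ∀ e ∈ c.edges, e ∈ H.edgeSet := by
      intro e he
      induction e with
      | _ x y =>
        have hx := hU x ⟨_, he, Sym2.mem_mk_left x y⟩
        have hy := hU y ⟨_, he, Sym2.mem_mk_right x y⟩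
        have hxy := c.adj_of_mem_edges he
        refine (hadj x y hxy).elim id fun h => ?_
        rcases hV x (p.fst_mem_support_of_mem_edges h) hx with rfl | rfl <;>
          rcases hV y (p.snd_mem_support_of_mem_edges h) hy with rfl | rfl
        · exact absurd rfl hxy.ne
        · exact huv
        · exact huv.symm
        · exact absurd rfl hxy.ne
    refine ⟨r, c.transfer H hsub, hc.transfer hsub, ?_, by simp⟩
    rw [Walk.isChordless_iff_forall_mem_edges]
    intro x y hx hy hxy
    rw [Walk.support_transfer] at hx hy
    rw [Walk.edges_transfer]
    exact hch.mem_edges hx hy (hle hxy)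
  -- an old and a new induced cycle share at most the edge between the ends of the path
  have hmixed : ∀ e, ∀ F ∈ cyclesThrough H' e, ∀ F' ∈ cyclesThrough H' e, ∀ w ∈ verts F,
      ∀ w' ∈ verts F', w ∉ e → w' ∉ e → (avoid H' {x | x ∈ e}).Reachable w w' →
      ¬ (∀ w ∈ verts F, w ∈ U) → ¬ (∀ w ∈ verts F', w ∈ U) := by
    intro e F hF F' hF' w hw w' hw' hwe hwe' hr hFU hFU'
    push Not at hFU
    obtain ⟨z, hz, hzU⟩ := hFU
    have hFd := hnew F hF.1 z hz hzU
    have heH := (hold F' hF'.1 hFU').subset_edgeSet hF'.2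
    have he := hF.2
    rw [hFd] at he
    rcases List.mem_cons.1 (show e ∈ s(v, u) :: p.edges from he) with rfl | he
    · have hwU : w ∉ U := by
        rw [hFd, mem_verts_edgeSet hd, Walk.support_cons, List.mem_cons] at hw
        simp only [Sym2.mem_iff, not_or] at hwe
        intro h
        rcases hV w (hw.resolve_left hwe.1) h with h | h
        · exact hwe.2 h
        · exact hwe.1 h
      refine reachable_invariant (U := Uᶜ) (fun x y hxy hx hy => ?_) hr hwU (hFU' w' hw')
      have := hnb x hx y hxy.1
      refine hxy.2.2 ?_
      rcases hV y (p.snd_mem_support_of_mem_edges this) hy with rfl | rfl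
      · exact Sym2.mem_mk_right _ _
      · exact Sym2.mem_mk_left _ _
    · exact hE e he heH
  refine ⟨?_, ?_, ?_⟩
  · intro x y hxy
    rcases hadj x y hxy with h | h
    · exact .inl (hH.mem_of_adj x y h)
    · exact .inr (p.fst_mem_support_of_mem_edges h)
  · intro z
    have key : ∀ x ∈ U ∪ {w | w ∈ p.support}, x ≠ z →
        ∃ t ∈ U, t ≠ z ∧ (avoid H' {z}).Reachable t x := by
      rintro x (hx | hx) hxz
      · exact ⟨x, hx, hxz, .refl _⟩
      · rcases reachable_end_of_isPath p hp hx hxz with h | h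
        · exact ⟨u, huU, h⟩
        · exact ⟨v, hvU, h⟩
    intro x y hx hy hxz hyz
    obtain ⟨s, hs, hsz, hsx⟩ := key x hx hxz
    obtain ⟨t, ht, htz, hty⟩ := key y hy hyz
    exact hsx.symm.trans (((hH.reachable z s t hs ht hsz htz).mono
      (avoid_mono hle subset_rfl)).trans hty)
  · intro e F hF F' hF' w hw w' hw' hwe hwe' hr
    by_cases hFU : ∀ w ∈ verts F, w ∈ U
    · by_cases hFU' : ∀ w ∈ verts F', w ∈ U
      · refine hH.eq_of_reachable e F ⟨hold F hF.1 hFU, hF.2⟩ F' ⟨hold F' hF'.1 hFU', hF'.2⟩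
          w hw w' hw' hwe hwe' ?_
        -- contract the attached path to one of its ends that is not removed
        set t := if v ∉ e then v else u with ht
        have hr' := reachable_map_of_adj (G' := avoid H {x | x ∈ e})
          (fun x => if x ∈ U then x else t) ?_ hr
        · simpa only [hFU w hw, hFU' w' hw', if_true] using hr'
        have key : ∀ x y, (avoid H' {x | x ∈ e}).Adj x y → x ∈ U → y ∉ U →
            (avoid H {x | x ∈ e}).Reachable x t := by
          intro x y hxy hx hy
          have h := hnb y hy x hxy.1.symm
          have hxe : x ∉ e := hxy.2.1
          rcases hV x (p.snd_mem_support_of_mem_edges h) hx with rfl | rfl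
          · by_cases hve : v ∈ e
            · simp only [ht, hve, not_true, if_false]
              exact .refl _
            · simp only [ht, hve, not_false_eq_true, if_true]
              exact Adj.reachable ⟨huv, hxe, hve⟩
          · simp only [ht, hxe, not_false_eq_true, if_true]
            exact .refl _
        intro x y hxy
        by_cases hx : x ∈ U <;> by_cases hy : y ∈ U <;> simp only [hx, hy, if_true, if_false]
        · refine Adj.reachable ⟨?_, hxy.2⟩
          refine (hadj x y hxy.1).elim id fun h => ?_
          rcases hV x (p.fst_mem_support_of_mem_edges h) hx with rfl | rfl <;>
            rcases hV y (p.snd_mem_support_of_mem_edges h) hy with rfl | rfl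
          · exact absurd rfl hxy.ne
          · exact huv
          · exact huv.symm
          · exact absurd rfl hxy.ne
        · exact key x y hxy hx hy
        · exact (key y x hxy.symm hy hx).symm
        · exact .refl _
      · exact absurd hFU (hmixed e F' hF' F hF w' hw' w hw hwe' hwe hr.symm hFU')
    · have hFU' := hmixed e F hF F' hF' w hw w' hw' hwe hwe' hr hFU
      push Not at hFU hFU'
      obtain ⟨z, hz, hzU⟩ := hFU
      obtain ⟨z', hz', hzU'⟩ := hFU'
      rw [hnew F hF.1 z hz hzU, hnew F' hF'.1 z' hz' hzU']

end Attach

lemma IsPolygonalPart.isEdgeSeparated {G : SimpleGraph V} {K : G.Subgraph}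
    (hK : IsPolygonalPart G K) : IsEdgeSeparated K.spanningCoe K.verts := by
  induction hK with
  | @cycle u p hp =>
    have hsub : ∀ e ∈ p.edges, e ∈ p.toSubgraph.spanningCoe.edgeSet := fun e he => by
      simpa using he
    have := IsEdgeSeparated.of_isCycle (hp.transfer hsub) (fun e he => by simpa using he)
    convert this using 1
    ext w
    simp
  | @attach K hK u v huv p hp hlen hE hV ih =>
    have hsub : ∀ e ∈ p.edges, e ∈ (K ⊔ p.toSubgraph).spanningCoe.edgeSet := fun e he => by
      simp only [Subgraph.edgeSet_spanningCoe, Subgraph.edgeSet_sup, Set.mem_union,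
        Walk.mem_edges_toSubgraph]
      exact .inr he
    have := IsEdgeSeparated.attach (H' := (K ⊔ p.toSubgraph).spanningCoe) ih
      (p := p.transfer _ hsub) huv (hp.transfer hsub) (fun x y h => Or.inl h) ?_ ?_ ?_
    · rw [Walk.support_transfer] at this
      convert this using 1
      ext w
      simp
    · intro x y h
      rcases (h : K.Adj x y ∨ p.toSubgraph.Adj x y) with h | h
      · exact .inl h
      · rw [Walk.edges_transfer]
        exact .inr (Walk.adj_toSubgraph_iff_mem_edges.1 h)
    · intro e he heK
      rw [Walk.edges_transfer] at he
      exact Set.disjoint_left.1 hE (by simpa using heK) (by simpa using he)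
    · intro w hw hwK
      rw [Walk.support_transfer] at hw
      have : w ∈ K.verts ∩ p.toSubgraph.verts := ⟨hwK, by simpa using hw⟩
      rw [hV] at this
      simpa using this

lemma IsPolygonal2Tree.isEdgeSeparated {G : SimpleGraph V} (hG : IsPolygonal2Tree G) :
    IsEdgeSeparated G Set.univ := by
  simpa using IsPolygonalPart.isEdgeSeparated hG

/-! ### The side of an induced cycle at one of its edges -/

/-- For an edge `e = ab` of an induced cycle `C` of `G`, the component of `G - {a, b}` that
contains the other vertices of `C`. -/
def side (G : SimpleGraph V) (e : Sym2 V) (C : Set (Sym2 V)) : Set V :=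
  {w | w ∉ e ∧ ∃ c ∈ verts C, c ∉ e ∧ (avoid G {x | x ∈ e}).Reachable c w}

section Side

variable {G : SimpleGraph V} {e : Sym2 V} {C F : Set (Sym2 V)} {x y : V}

lemma mem_side_of_mem_verts (hx : x ∈ verts C) (hxe : x ∉ e) : x ∈ side G e C :=
  ⟨hxe, x, hx, hxe, .refl _⟩

lemma mem_side_of_reachable (hx : x ∈ side G e C) (hye : y ∉ e)
    (h : (avoid G {x | x ∈ e}).Reachable x y) : y ∈ side G e C := by
  obtain ⟨-, c, hc, hce, hcx⟩ := hx
  exact ⟨hye, c, hc, hce, hcx.trans h⟩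

lemma mem_side_of_adj (hx : x ∈ side G e C) (hxy : G.Adj x y) (hye : y ∉ e) : y ∈ side G e C :=
  mem_side_of_reachable hx hye (Adj.reachable ⟨hxy, hx.1, hye⟩)

/-- An induced cycle does not meet both sides of an edge. -/
lemma IsInducedCycle.mem_side (hF : IsInducedCycle G F) (he : e ∈ G.edgeSet) (hx : x ∈ verts F)
    (hxs : x ∈ side G e C) (hy : y ∈ verts F) (hye : y ∉ e) : y ∈ side G e C :=
  mem_side_of_reachable hxs hye (hF.reachable_avoid_edge he hx hy hxs.1 hye)

lemma IsEdgeSeparated.eq_of_mem_side (hG : IsEdgeSeparated G Set.univ)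
    (hC : C ∈ cyclesThrough G e) (hF : F ∈ cyclesThrough G e) (hx : x ∈ verts F)
    (hxs : x ∈ side G e C) : F = C := by
  obtain ⟨hxe, c, hc, hce, hcx⟩ := hxs
  exact hG.eq_of_reachable e F hF C hC x hx c hc hxe hce hcx.symm

lemma IsEdgeSeparated.eq_of_mem_side_of_mem_side (hG : IsEdgeSeparated G Set.univ)
    (hC : C ∈ cyclesThrough G e) (hF : F ∈ cyclesThrough G e) (hx : x ∈ side G e C)
    (hx' : x ∈ side G e F) : F = C := by
  obtain ⟨hxe, c, hc, hce, hcx⟩ := hx'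
  exact hG.eq_of_mem_side hC hF hc (mem_side_of_reachable hx hce hcx.symm)

/-- A connection to one end of an edge that avoids the other end stays outside the side it
starts outside of, since that side can only be entered through the two ends. -/
lemma reachable_avoid_side {G' : SimpleGraph V} (hG' : G' ≤ G) {a b : V}
    (he : ∀ w ∈ e, w = a ∨ w = b) (hx : x ∉ side G e C) (h : (avoid G' {b}).Reachable x a) :
    (avoid G' (side G e C ∪ {b})).Reachable x a := by
  obtain ⟨p⟩ := h
  induction p with
  | nil => exact .refl _
  | @cons x y a hxy q ih =>
    by_cases hxa : x = a
    · exact hxa ▸ .refl _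
    · have hxe : x ∉ e := fun h => (he x h).elim hxa hxy.2.1
      have hy : y ∉ side G e C := fun hy => hx (mem_side_of_adj hy (hG' hxy.1).symm hxe)
      refine Reachable.trans (Adj.reachable ⟨hxy.1, ?_, ?_⟩) (ih he hy)
      · exact fun h => h.elim hx hxy.2.1
      · exact fun h => h.elim hy hxy.2.2

lemma IsEdgeSeparated.reachable_avoid_side (hG : IsEdgeSeparated G Set.univ) (he : e ∈ G.edgeSet)
    (hx : x ∉ side G e C) (hy : y ∉ side G e C) : (avoid G (side G e C)).Reachable x y := by
  induction e with
  | _ a b =>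
  have ha : a ∉ side G s(a, b) C := fun h => h.1 (Sym2.mem_mk_left a b)
  have hb : b ∉ side G s(a, b) C := fun h => h.1 (Sym2.mem_mk_right a b)
  have hab : G.Adj a b := he
  have key : ∀ w, w ∉ side G s(a, b) C → (avoid G (side G s(a, b) C)).Reachable w a := by
    intro w hw
    by_cases hwb : w = b
    · subst hwb
      exact Adj.reachable ⟨hab.symm, hb, ha⟩
    · exact (PolygonalTwoTree.reachable_avoid_side le_rfl
        (fun w h => Sym2.mem_iff.1 h) hw
        (hG.reachable b w a trivial trivial hwb hab.ne)).mono
          (avoid_mono le_rfl Set.subset_union_left)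
  exact (key x hx).trans (key y hy).symm

/-- If `e` and `e'` are distinct edges of the induced cycle `C`, what lies across `e` from `C` is
on the side of `C` at `e'`. -/
lemma IsEdgeSeparated.mem_side_of_notMem_side (hG : IsEdgeSeparated G Set.univ)
    (hC : C ∈ cyclesThrough G e) {e' : Sym2 V} (he' : e' ∈ C) (hne : e' ≠ e)
    (hx : x ∉ side G e C) (hxe : x ∉ e) : x ∈ side G e' C := by
  have he := hC.1.subset_edgeSet hC.2
  have hadj' := hC.1.subset_edgeSet he'
  obtain ⟨a, b, rfl, hae'⟩ : ∃ a b, e = s(a, b) ∧ a ∉ e' := by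
    induction e with
    | _ a b =>
      by_cases ha : a ∈ e'
      · refine ⟨b, a, Sym2.eq_swap, fun hb => hne ?_⟩
        exact (Sym2.mem_and_mem_iff (show G.Adj a b from he).ne).1 ⟨ha, hb⟩
      · exact ⟨a, b, rfl, ha⟩
  have hab : G.Adj a b := he
  have hxb : x ≠ b := fun h => hxe (h ▸ Sym2.mem_mk_right a b)
  have hsub : ∀ w ∈ e', w ∈ side G s(a, b) C ∪ {b} := by
    intro w hw
    by_cases hwe : w ∈ s(a, b)
    · rcases Sym2.mem_iff.1 hwe with rfl | rfl
      · exact absurd hw hae'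
      · exact .inr rfl
    · exact .inl (mem_side_of_mem_verts ⟨e', he', hw⟩ hwe)
  have h := PolygonalTwoTree.reachable_avoid_side (C := C) le_rfl
    (fun w h => Sym2.mem_iff.1 h) hx (hG.reachable b x a trivial trivial hxb hab.ne)
  refine ⟨fun h => (hsub x h).elim hx hxb, a, ⟨_, hC.2, Sym2.mem_mk_left a b⟩, hae', ?_⟩
  exact h.symm.mono (avoid_mono le_rfl hsub)

end Side

/-! ### Two-connected components -/

lemma preconnected_iff_spanningCoe {H : SimpleGraph V} {B : H.Subgraph} :
    B.Preconnected ↔ ∀ x ∈ B.verts, ∀ y ∈ B.verts, B.spanningCoe.Reachable x y := by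
  classical
  constructor
  · intro h x hx y hy
    exact reachable_map_of_adj (G := B.coe) (fun x => x.1) (fun _ _ h => Adj.reachable h)
      (h ⟨x, hx⟩ ⟨y, hy⟩)
  · refine fun h => ⟨?_⟩
    rintro ⟨x, hx⟩ ⟨y, hy⟩
    have := reachable_map_of_adj (G' := B.coe)
      (fun w => if hw : w ∈ B.verts then ⟨w, hw⟩ else ⟨x, hx⟩) ?_ (h x hx y hy)
    · simpa only [hx, hy, dif_pos] using this
    · intro a b hab
      have ha : a ∈ B.verts := B.edge_vert hab
      have hb : b ∈ B.verts := B.edge_vert hab.symm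
      simp only [ha, hb, dif_pos]
      exact Adj.reachable hab

lemma spanningCoe_deleteVerts {H : SimpleGraph V} (B : H.Subgraph) (S : Set V) :
    (B.deleteVerts S).spanningCoe = avoid B.spanningCoe S := by
  ext x y
  simp only [Subgraph.spanningCoe_adj, Subgraph.deleteVerts_adj, avoid]
  exact ⟨fun h => ⟨h.2.2.2.2, h.2.1, h.2.2.2.1⟩,
    fun h => ⟨B.edge_vert h.1, h.2.1, B.edge_vert h.1.symm, h.2.2, h.1⟩⟩

lemma isTwoConnected_iff {H : SimpleGraph V} {B : H.Subgraph} :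
    IsTwoConnected B ↔ B.verts.Nonempty ∧
      (∀ x ∈ B.verts, ∀ y ∈ B.verts, B.spanningCoe.Reachable x y) ∧
      ∀ z, ∀ x ∈ B.verts, ∀ y ∈ B.verts, x ≠ z → y ≠ z →
        (avoid B.spanningCoe {z}).Reachable x y := by
  rw [IsTwoConnected, Subgraph.connected_iff, preconnected_iff_spanningCoe]
  simp only [preconnected_iff_spanningCoe, spanningCoe_deleteVerts, Subgraph.deleteVerts_verts,
    Set.mem_sdiff, Set.mem_singleton_iff]
  constructor
  · rintro ⟨⟨h2, h1⟩, h3⟩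
    exact ⟨h1, h2, fun z x hx y hy hxz hyz => h3 z x ⟨hx, hxz⟩ y ⟨hy, hyz⟩⟩
  · rintro ⟨h1, h2, h3⟩
    exact ⟨⟨h2, h1⟩, fun z x hx y hy => h3 z x hx.1 y hy.1 hx.2 hy.2⟩

lemma isTwoConnected_toSubgraph_of_isCycle {H : SimpleGraph V} {u : V} {p : H.Walk u u}
    (hp : p.IsCycle) : IsTwoConnected p.toSubgraph := by
  have hsub : ∀ e ∈ p.edges, e ∈ p.toSubgraph.spanningCoe.edgeSet := fun e he => by
    simpa using he
  have h := fun z x (hx : x ∈ p.support) y (hy : y ∈ p.support) hxz hyz =>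
    reachable_avoid_of_isCycle (z := z) (hp.transfer hsub) (x := x) (y := y) (by simpa) (by simpa)
      hxz hyz
  rw [isTwoConnected_iff]
  simp only [Walk.mem_verts_toSubgraph]
  refine ⟨⟨u, by simp⟩, ?_, h⟩
  simpa using preconnected_iff_spanningCoe.1 p.toSubgraph_connected.preconnected

lemma IsTwoConnected.sup {H : SimpleGraph V} {B B' : H.Subgraph} (hB : IsTwoConnected B)
    (hB' : IsTwoConnected B') {a b : V} (hab : a ≠ b) (ha : a ∈ B.verts) (hb : b ∈ B.verts)
    (ha' : a ∈ B'.verts) (hb' : b ∈ B'.verts) : IsTwoConnected (B ⊔ B') := by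
  rw [isTwoConnected_iff] at *
  obtain ⟨h1, h2, h3⟩ := hB
  obtain ⟨-, h2', h3'⟩ := hB'
  have hle : B.spanningCoe ≤ (B ⊔ B').spanningCoe := fun _ _ h => .inl h
  have hle' : B'.spanningCoe ≤ (B ⊔ B').spanningCoe := fun _ _ h => .inr h
  refine ⟨⟨a, .inl ha⟩, ?_, fun z => ?_⟩
  · have key : ∀ x ∈ (B ⊔ B').verts, (B ⊔ B').spanningCoe.Reachable x a := by
      rintro x (hx | hx)
      · exact (h2 x hx a ha).mono hle
      · exact (h2' x hx a ha').mono hle'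
    exact fun x hx y hy => (key x hx).trans (key y hy).symm
  · obtain ⟨c, hc, hc', hcz⟩ : ∃ c ∈ B.verts, c ∈ B'.verts ∧ c ≠ z := by
      by_cases h : a = z
      · exact ⟨b, hb, hb', fun h' => hab (h.trans h'.symm)⟩
      · exact ⟨a, ha, ha', h⟩
    have key : ∀ x ∈ (B ⊔ B').verts, x ≠ z → (avoid (B ⊔ B').spanningCoe {z}).Reachable x c := by
      rintro x (hx | hx) hxz
      · exact (h3 z x hx c hc hxz hcz).mono (avoid_mono hle subset_rfl)
      · exact (h3' z x hx c hc' hxz hcz).mono (avoid_mono hle' subset_rfl)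
    exact fun x hx y hy hxz hyz => (key x hx hxz).trans (key y hy hyz).symm

lemma IsTwoConnectedComponent.toSubgraph_le {H : SimpleGraph V} {B : H.Subgraph}
    (hB : IsTwoConnectedComponent B) {e : Sym2 V} (he : e ∈ B.edgeSet) {u : V} {p : H.Walk u u}
    (hp : p.IsCycle) (hep : e ∈ p.edges) : p.toSubgraph ≤ B := by
  induction e with
  | _ a b =>
  have h : B.Adj a b := he
  have hab := p.adj_of_mem_edges hep
  exact le_sup_right.trans (hB.2 (hB.1.sup (isTwoConnected_toSubgraph_of_isCycle hp) hab.ne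
    (B.edge_vert h) (B.edge_vert h.symm)
    (p.mem_verts_toSubgraph.2 (p.fst_mem_support_of_mem_edges hep))
    (p.mem_verts_toSubgraph.2 (p.snd_mem_support_of_mem_edges hep))) le_sup_left)

lemma exists_isTwoConnectedComponent [Finite V] {H : SimpleGraph V} {u : V} {p : H.Walk u u}
    (hp : p.IsCycle) : ∃ B : H.Subgraph, IsTwoConnectedComponent B ∧ p.toSubgraph ≤ B := by
  obtain ⟨B, h1, h2⟩ := (Set.toFinite {B : H.Subgraph | IsTwoConnected B}).exists_le_maximal
    (isTwoConnected_toSubgraph_of_isCycle hp)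
  exact ⟨B, h2, h1⟩

/-! ### The support of an edge as a cut -/

section Support

variable {G : SimpleGraph V} {A : Set (Sym2 V)} {e : Sym2 V} {C : Set (Sym2 V)}

/-- If `C` is the only induced cycle of `G - A` through `e`, the two-connected component of `e`
in `G - A` lies on the side of `C`: otherwise `e` would lie on a cycle of `G - A` that avoids
this side. -/
lemma mem_of_mem_verts_of_notMem_side
    (hC : C ∈ cyclesThrough (G.deleteEdges A) e)
    (hu : ∀ F ∈ cyclesThrough (G.deleteEdges A) e, F = C) {B : (G.deleteEdges A).Subgraph}
    (hB : IsTwoConnectedComponent B) (he : e ∈ B.edgeSet) {w : V} (hw : w ∈ B.verts)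
    (hws : w ∉ side G e C) : w ∈ e := by
  by_contra hwe
  induction e with
  | _ a b =>
  have ha : a ∉ side G s(a, b) C := fun h => h.1 (Sym2.mem_mk_left a b)
  have hb : b ∉ side G s(a, b) C := fun h => h.1 (Sym2.mem_mk_right a b)
  have hBab : B.Adj a b := he
  have hab := B.adj_sub hBab
  simp only [Sym2.mem_iff, not_or] at hwe
  have h3 := (isTwoConnected_iff.1 hB.1).2.2
  have hle : B.spanningCoe ≤ G.deleteEdges A := B.spanningCoe_le
  have ra := reachable_avoid_side (e := s(a, b)) (deleteEdges_le A)
    (fun w h => Sym2.mem_iff.1 h) hws ((h3 b w hw a (B.edge_vert hBab) hwe.2 hab.ne).mono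
      (avoid_mono hle subset_rfl))
  have rb := reachable_avoid_side (e := s(a, b)) (deleteEdges_le A)
    (fun w h => (Sym2.mem_iff.1 h).symm) hws
    ((h3 a w hw b (B.edge_vert hBab.symm) hwe.1 hab.ne.symm).mono (avoid_mono hle subset_rfl))
  have hdel : ∀ c ∈ s(a, b), avoid (G.deleteEdges A) (side G s(a, b) C ∪ {c}) ≤
      (avoid (G.deleteEdges A) (side G s(a, b) C)).deleteEdges {s(a, b)} := by
    intro c hc x y hxy
    refine deleteEdges_adj.2 ⟨⟨hxy.1, fun h => hxy.2.1 (.inl h), fun h => hxy.2.2 (.inl h)⟩, ?_⟩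
    intro h
    rw [← Set.mem_singleton_iff.1 h] at hc
    rcases Sym2.mem_iff.1 hc with rfl | rfl
    · exact hxy.2.1 (.inr rfl)
    · exact hxy.2.2 (.inr rfl)
  obtain ⟨u, c, hc, hec⟩ := adj_and_reachable_delete_edges_iff_exists_cycle.1
    ⟨show (avoid (G.deleteEdges A) (side G s(a, b) C)).Adj a b from ⟨hab, ha, hb⟩,
      (ra.mono (hdel b (Sym2.mem_mk_right a b))).symm.trans
        (rb.mono (hdel a (Sym2.mem_mk_left a b)))⟩
  obtain ⟨F, hF, hFs⟩ := exists_inducedCycle_of_isCycle (e := s(a, b))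
    (hc.mapLe (avoid_le _ _)) (by simpa using hec)
  obtain rfl := hu F hF
  obtain ⟨z, hz, hze⟩ := hF.1.exists_vert_notMem s(a, b)
  have hzc : z ∈ c.support := by simpa using hFs hz
  obtain ⟨e', he', hze'⟩ := (mem_verts_edgeSet hc).2 hzc
  obtain ⟨y, rfl⟩ := hze'
  exact (c.adj_of_mem_edges he').2.1 (mem_side_of_mem_verts hz hze)

/-- A path that witnesses `q ∈ Sup G A e` closes up with `q` to a cycle of `G` that avoids the side
of `C` at `e`. -/
lemma exists_isCycle_of_mem_Sup (hG : IsEdgeSeparated G Set.univ) (hAG : A ⊆ G.edgeSet)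
    (hC : C ∈ cyclesThrough (G.deleteEdges A) e) (hCG : IsInducedCycle G C)
    {q : Sym2 V} (hq : q ∈ Sup G A e) :
    ∃ (u : V) (Z : G.Walk u u), Z.IsCycle ∧ e ∈ Z.edges ∧ q ∈ Z.edges ∧
      (∀ e' ∈ Z.edges, e' ∈ A → e' = q) ∧ ∀ w ∈ Z.support, w ∉ side G e C := by
  obtain ⟨hqA, B, hB, he, u, v, P, rfl, hP, hPe, hPv⟩ := hq
  have hle : G.deleteEdges A ≤ G := deleteEdges_le A
  have huv : G.Adj u v := hAG hqA
  have hPA : ∀ e' ∈ P.edges, e' ∉ A := fun e' he' h => by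
    have := P.edges_subset_edgeSet he'
    rw [edgeSet_deleteEdges] at this
    exact this.2 h
  have heP : e ∈ P.edges := by
    have : e ∈ (P.toSubgraph ⊓ B).edgeSet := by rw [hPe]; rfl
    rw [Subgraph.edgeSet_inf] at this
    exact (P.mem_edges_toSubgraph).1 this.1
  have hZ : (Walk.cons huv.symm (P.mapLe hle)).IsCycle := by
    rw [Walk.cons_isCycle_iff]
    refine ⟨hP.mapLe hle, ?_⟩
    rw [Walk.edges_mapLe_eq_edges, Sym2.eq_swap]
    exact fun h => hPA _ h hqA
  have hZe : e ∈ (Walk.cons huv.symm (P.mapLe hle)).edges := by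
    rw [Walk.edges_cons, Walk.edges_mapLe_eq_edges]
    exact List.mem_cons_of_mem _ heP
  have hZs : ∀ w ∈ (Walk.cons huv.symm (P.mapLe hle)).support, w ∈ P.support := by
    intro w hw
    rw [Walk.support_cons, Walk.support_mapLe_eq_support, List.mem_cons] at hw
    rcases hw with rfl | hw
    · exact P.end_mem_support
    · exact hw
  refine ⟨v, _, hZ, hZe, by rw [Walk.edges_cons, Sym2.eq_swap]; exact List.mem_cons_self, ?_, ?_⟩
  · intro e' he' heA
    rw [Walk.edges_cons, Walk.edges_mapLe_eq_edges, List.mem_cons] at he'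
    rcases he' with rfl | he'
    · exact Sym2.eq_swap
    · exact absurd heA (hPA e' he')
  · intro x hx hxs
    obtain ⟨F, hF, hFs⟩ := exists_inducedCycle_of_isCycle hZ hZe
    obtain ⟨w, hw, hwe⟩ := hF.1.exists_vert_notMem e
    have hwZ := hFs hw
    have hws := mem_side_of_reachable hxs hwe
      (reachable_avoid_edge_of_isCycle hZ hZe hx hwZ hxs.1 hwe)
    obtain rfl := hG.eq_of_mem_side ⟨hCG, hC.2⟩ hF hw hws
    -- `C` lies in the two-connected component of `e`, which the path meets in `e` only
    obtain ⟨r, c, hc, -, hcF⟩ := hC.1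
    have hwB : w ∈ B.verts := by
      refine (hB.toSubgraph_le he hc (by rw [← hcF] at hF; exact hF.2)).1 ?_
      rw [Walk.mem_verts_toSubgraph, ← mem_verts_edgeSet hc, hcF]
      exact hw
    have : w ∈ (P.toSubgraph ⊓ B).verts := ⟨P.mem_verts_toSubgraph.2 (hZs w hwZ), hwB⟩
    rw [hPv] at this
    exact hwe this

/-- If `C` is the only induced cycle of `G - A` through `e`, then `Sup G A e`, together with `e`, is
the only set of deleted edges and `e`, off the side of `C` at `e`, that contains `e` and meets
every induced cycle off this side evenly. -/
lemma Sup_eq_of_even [Finite V] (hG : IsEdgeSeparated G Set.univ) (hAG : A ⊆ G.edgeSet)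
    (hC : C ∈ cyclesThrough (G.deleteEdges A) e) (hCG : IsInducedCycle G C)
    (hu : ∀ F ∈ cyclesThrough (G.deleteEdges A) e, F = C)
    (hconn : ∀ x y, x ∉ side G e C → y ∉ side G e C →
      (avoid (G.deleteEdges A) (side G e C)).Reachable x y)
    {T : Set (Sym2 V)} (hTA : T ⊆ A) (hTs : ∀ q ∈ T, ∀ w ∈ q, w ∉ side G e C)
    (heven : ∀ F, IsInducedCycle G F → verts F ⊆ (side G e C)ᶜ → Even (F ∩ insert e T).ncard) :
    Sup G A e = T := by
  have heA : e ∉ A := by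
    have := hC.1.subset_edgeSet hC.2
    rw [edgeSet_deleteEdges] at this
    exact this.2
  ext q
  constructor
  · intro hq
    obtain ⟨u, Z, hZ, heZ, hqZ, hZA, hZs⟩ := exists_isCycle_of_mem_Sup hG hAG hC hCG hq
    by_contra hqT
    have h := even_ncard_inter_of_isCycle heven hZ hZs
    have : Z.edgeSet ∩ insert e T = {e} := by
      ext e'
      constructor
      · rintro ⟨h1, h2 | h2⟩
        · exact h2
        · exact absurd (hZA e' h1 (hTA h2) ▸ h2) hqT
      · rintro rfl
        exact ⟨heZ, .inl rfl⟩
    rw [this, Set.ncard_singleton] at h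
    exact absurd h (by decide)
  · intro hqT
    have hqA := hTA hqT
    induction q with
    | _ u v =>
    have hle : avoid (G.deleteEdges A) (side G e C) ≤ G := (avoid_le _ _).trans (deleteEdges_le A)
    have hus := hTs _ hqT u (Sym2.mem_mk_left u v)
    have hvs := hTs _ hqT v (Sym2.mem_mk_right u v)
    obtain ⟨P, hP⟩ := (hconn u v hus hvs).exists_isPath
    have hPA : ∀ e' ∈ P.edges, e' ∉ A := fun e' he' h => by
      have := edgeSet_mono (avoid_le _ _) (P.edges_subset_edgeSet he')
      rw [edgeSet_deleteEdges] at this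
      exact this.2 h
    have huv : G.Adj u v := hAG hqA
    have hPs := walk_avoid_support P hus
    have hZ : (Walk.cons huv.symm (P.mapLe hle)).IsCycle := by
      rw [Walk.cons_isCycle_iff]
      refine ⟨hP.mapLe hle, ?_⟩
      rw [Walk.edges_mapLe_eq_edges, Sym2.eq_swap]
      exact fun h => hPA _ h hqA
    have h := even_ncard_inter_of_isCycle heven hZ (fun w hw => by
      rw [Walk.support_cons, Walk.support_mapLe_eq_support, List.mem_cons] at hw
      rcases hw with rfl | hw
      · exact hvs
      · exact hPs w hw)
    -- the cycle meets `insert e T` in `uv`, so it also contains `e`, the only other candidate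
    have heP : e ∈ P.edges := by
      by_contra heP
      have : (Walk.cons huv.symm (P.mapLe hle)).edgeSet ∩ insert e T = {s(u, v)} := by
        ext e'
        simp only [Walk.edgeSet, Walk.edges_cons, Walk.edges_mapLe_eq_edges, List.mem_cons,
          Set.mem_inter_iff, Set.mem_ofPred_eq, Set.mem_insert_iff, Set.mem_singleton_iff]
        constructor
        · rintro ⟨h1 | h1, h2⟩
          · exact h1.trans Sym2.eq_swap
          · rcases h2 with rfl | h2
            · exact absurd h1 heP
            · exact absurd (hTA h2) (hPA _ h1)
        · rintro rfl
          exact ⟨.inl Sym2.eq_swap, .inr hqT⟩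
      rw [this, Set.ncard_singleton] at h
      exact absurd h (by decide)
    obtain ⟨r, c, hc, -, hcC⟩ := hC.1
    have hec : e ∈ c.edges := by
      have := hC.2
      rw [← hcC] at this
      exact this
    obtain ⟨B, hB, hcB⟩ := exists_isTwoConnectedComponent hc
    have heB : e ∈ B.edgeSet := Subgraph.edgeSet_mono hcB (c.mem_edges_toSubgraph.2 hec)
    refine ⟨hqA, B, hB, heB, u, v, P.mapLe (avoid_le _ _), rfl, hP.mapLe _, ?_, ?_⟩
    · ext e'
      rw [Subgraph.edgeSet_inf, Set.mem_inter_iff, Walk.mem_edges_toSubgraph,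
        Walk.edges_mapLe_eq_edges, Set.mem_singleton_iff]
      constructor
      · rintro ⟨h1, h2⟩
        induction e' with
        | _ x y =>
          have hxy : B.Adj x y := h2
          have hx := mem_of_mem_verts_of_notMem_side hC hu hB heB (B.edge_vert hxy)
            (hPs x (P.fst_mem_support_of_mem_edges h1))
          have hy := mem_of_mem_verts_of_notMem_side hC hu hB heB (B.edge_vert hxy.symm)
            (hPs y (P.snd_mem_support_of_mem_edges h1))
          exact ((Sym2.mem_and_mem_iff hxy.ne).1 ⟨hx, hy⟩).symm
      · rintro rfl
        exact ⟨heP, heB⟩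
    · ext w
      simp only [Subgraph.verts_inf, Set.mem_inter_iff, Walk.mem_verts_toSubgraph,
        Walk.support_mapLe_eq_support, Set.mem_ofPred_eq]
      constructor
      · rintro ⟨h1, h2⟩
        exact mem_of_mem_verts_of_notMem_side hC hu hB heB h2 (hPs w h1)
      · intro hw
        obtain ⟨y, rfl⟩ := hw
        exact ⟨P.fst_mem_support_of_mem_edges heP, B.edge_vert heB⟩

end Support

/-! ### Invariants of the algorithm -/

lemma cyclesThrough_deleteEdges_singleton {H : SimpleGraph V} {e : Sym2 V} {C : Set (Sym2 V)}
    (he : cyclesThrough H e = {C}) (q : Sym2 V) :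
    cyclesThrough (H.deleteEdges {e}) q = cyclesThrough H q \ {C} := by
  have hC : C ∈ cyclesThrough H e := by rw [he]; rfl
  have hu : ∀ F ∈ cyclesThrough H e, F = C := fun F hF => by rwa [he] at hF
  ext F
  simp only [cyclesThrough, Set.mem_ofPred_eq, Set.mem_sdiff, Set.mem_singleton_iff,
    isInducedCycle_deleteEdges_singleton_iff
      (fun F hF F' hF' => (hu F hF).trans (hu F' hF').symm)]
  constructor
  · rintro ⟨⟨h1, h2⟩, h3⟩
    refine ⟨⟨h1, h3⟩, ?_⟩
    rintro rfl
    exact h2 hC.2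
  · rintro ⟨⟨h1, h3⟩, h2⟩
    exact ⟨⟨h1, fun h => h2 (hu F ⟨h1, h⟩)⟩, h3⟩

/-- The edges in `bound G A` are those on exactly one induced cycle of `G - A`. -/
lemma mem_bound_iff {G : SimpleGraph V} {A : Set (Sym2 V)} {e : Sym2 V} :
    e ∈ bound G A ↔ ∃ C, cyclesThrough (G.deleteEdges A) e = {C} := by
  constructor
  · rintro ⟨⟨he, hint⟩, hb⟩
    rw [isBridge_iff_forall_cycle_notMem he] at hb
    push Not at hb
    obtain ⟨u, p, hp, hep⟩ := hb
    obtain ⟨C, hC, -⟩ := exists_inducedCycle_of_isCycle hp hep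
    refine ⟨C, Set.eq_singleton_iff_unique_mem.2 ⟨hC, fun F hF => ?_⟩⟩
    by_contra hne
    exact hint ⟨he, F, hF, C, hC, hne⟩
  · rintro ⟨C, hC⟩
    have hCe : C ∈ cyclesThrough (G.deleteEdges A) e := by rw [hC]; rfl
    have he := hCe.1.subset_edgeSet hCe.2
    refine ⟨⟨he, ?_⟩, ?_⟩
    · rintro ⟨-, F, hF, F', hF', hne⟩
      rw [hC] at hF hF'
      exact hne (hF.trans hF'.symm)
    · obtain ⟨u, p, hp, -, hpC⟩ := hCe.1
      exact fun hb => hb.notMem_edges_of_isCycle hp (by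
        have := hCe.2
        rw [← hpC] at this
        exact this)

lemma notMem_of_mem_cyclesThrough {G : SimpleGraph V} {A : Set (Sym2 V)} {e : Sym2 V}
    {C : Set (Sym2 V)} (hC : C ∈ cyclesThrough (G.deleteEdges A) e) : e ∉ A := by
  have := hC.1.subset_edgeSet hC.2
  rw [edgeSet_deleteEdges] at this
  exact this.2

/-- The invariant of the main loop: deleting edges has only removed induced cycles of `G`, the heap
holds the edges on exactly one remaining induced cycle, and `pCycles` and `unpCount` record,
for the remaining edges, the induced cycles that have been removed, and the number of those
that have not. -/
structure AlgState.Invariant (G : SimpleGraph V) (s : AlgState V) : Prop where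
  subset : s.A ⊆ G.edgeSet
  isInducedCycle_iff : ∀ F, IsInducedCycle (G.deleteEdges s.A) F ↔
    IsInducedCycle G F ∧ Disjoint F s.A
  mem_Q : ∀ q, q ∈ s.Q ↔ (cyclesThrough (G.deleteEdges s.A) q).ncard = 1
  pCycles : ∀ q ∉ s.A, cyclesThrough G q \ s.pCycles q = cyclesThrough (G.deleteEdges s.A) q
  unpCount : ∀ q ∉ s.A, s.unpCount q = (cyclesThrough (G.deleteEdges s.A) q).ncard

lemma AlgState.invariant_init (G : SimpleGraph V) : (AlgState.init G).Invariant G where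
  subset := Set.empty_subset _
  isInducedCycle_iff F := by simp [AlgState.init]
  mem_Q q := by
    rw [Set.ncard_eq_one]
    exact mem_bound_iff
  pCycles q _ := by simp [AlgState.init]
  unpCount q _ := by simp [AlgState.init]

lemma AlgState.Invariant.step [Finite V] {G : SimpleGraph V} {s s' : AlgState V} {e : Sym2 V}
    (hs : s.Invariant G) (h : AlgStep G s e s') :
    s'.Invariant G ∧ ∃ C, cyclesThrough (G.deleteEdges s.A) e = {C} ∧ s' = s.update e C := by
  classical
  obtain ⟨heQ, -, C, hC, rfl⟩ := h
  obtain ⟨C', hC'⟩ := Set.ncard_eq_one.1 ((hs.mem_Q e).1 heQ)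
  have hmem' : C' ∈ cyclesThrough (G.deleteEdges s.A) e := by rw [hC']; rfl
  have heA := notMem_of_mem_cyclesThrough hmem'
  rw [hs.pCycles e heA] at hC
  clear hC' hmem'
  have hmem : C ∈ cyclesThrough (G.deleteEdges s.A) e := by rw [hC]; rfl
  have hdel : G.deleteEdges (s.A ∪ {e}) = (G.deleteEdges s.A).deleteEdges {e} := by
    rw [deleteEdges_deleteEdges]
  have hthr : ∀ q, cyclesThrough (G.deleteEdges (s.A ∪ {e})) q =
      cyclesThrough (G.deleteEdges s.A) q \ {C} := fun q => by
    rw [hdel, cyclesThrough_deleteEdges_singleton hC]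
  have hin : ∀ q ∈ C, C ∈ cyclesThrough (G.deleteEdges s.A) q := fun q hq => ⟨hmem.1, hq⟩
  have hout : ∀ q, q ∉ C → C ∉ cyclesThrough (G.deleteEdges s.A) q := fun q hq h => hq h.2
  have hfin : ∀ q, (cyclesThrough (G.deleteEdges s.A) q).Finite := fun q => Set.toFinite _
  refine ⟨⟨?_, ?_, ?_, ?_, ?_⟩, C, hC, rfl⟩
  · rintro q (hq | rfl)
    · exact hs.subset hq
    · exact ((hs.isInducedCycle_iff C).1 hmem.1).1.subset_edgeSet hmem.2
  · intro F
    change IsInducedCycle (G.deleteEdges (s.A ∪ {e})) F ↔ _ ∧ Disjoint F (s.A ∪ {e})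
    rw [hdel, isInducedCycle_deleteEdges_singleton_iff, hs.isInducedCycle_iff,
      Set.disjoint_union_right, Set.disjoint_singleton_right, and_assoc]
    intro F hF F' hF'
    rw [hC] at hF hF'
    exact hF.trans hF'.symm
  · intro q
    change q ∈ ((s.Q \ {e}) ∪ {q | q ∈ C \ {e} ∧ s.unpCount q - 1 = 1}) \
      {q | q ∈ C \ {e} ∧ s.unpCount q - 1 = 0} ↔
        (cyclesThrough (G.deleteEdges (s.A ∪ {e})) q).ncard = 1
    rw [hthr]
    by_cases hqe : q = e
    · subst hqe
      simp [hC]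
    by_cases hqC : q ∈ C
    · have hqA := notMem_of_mem_cyclesThrough (hin q hqC)
      rw [Set.ncard_sdiff_singleton_of_mem (hin q hqC)]
      simp only [Set.mem_sdiff, Set.mem_union, Set.mem_ofPred_eq, Set.mem_singleton_iff, hqe, hqC,
        not_false_eq_true, and_true, true_and, hs.mem_Q, hs.unpCount q hqA]
      lia
    · rw [Set.sdiff_singleton_eq_self (hout q hqC)]
      simp [hqe, hqC, hs.mem_Q]
  · intro q hq
    have hqA : q ∉ s.A := fun h => hq (.inl h)
    have hqe : q ≠ e := fun h => hq (.inr h)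
    change cyclesThrough G q \ (if q ∈ C \ {e} then s.pCycles q ∪ {C} else s.pCycles q) =
      cyclesThrough (G.deleteEdges (s.A ∪ {e})) q
    rw [hthr]
    by_cases hqC : q ∈ C
    · rw [if_pos ⟨hqC, hqe⟩, ← hs.pCycles q hqA, Set.sdiff_sdiff]
    · rw [if_neg fun h => hqC h.1, hs.pCycles q hqA, Set.sdiff_singleton_eq_self (hout q hqC)]
  · intro q hq
    have hqA : q ∉ s.A := fun h => hq (.inl h)
    have hqe : q ≠ e := fun h => hq (.inr h)
    change (if q ∈ C \ {e} then s.unpCount q - 1 else s.unpCount q) =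
      (cyclesThrough (G.deleteEdges (s.A ∪ {e})) q).ncard
    rw [hthr]
    by_cases hqC : q ∈ C
    · rw [if_pos ⟨hqC, hqe⟩, hs.unpCount q hqA, Set.ncard_sdiff_singleton_of_mem (hin q hqC)]
    · rw [if_neg fun h => hqC h.1, hs.unpCount q hqA, Set.sdiff_singleton_eq_self (hout q hqC)]

open Classical in
/-- The part of an execution of the algorithm that matters for the supports: the sets of deleted
edges, the induced cycle `D t` that is processed in iteration `t + 1`, and the accumulated
values. -/
structure IsEliminationRun (G : SimpleGraph V) (j : ℕ) (S : ℕ → AlgState V) (x : ℕ → Sym2 V)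
    (D : ℕ → Set (Sym2 V)) : Prop where
  subset : ∀ t ≤ j, (S t).A ⊆ G.edgeSet
  isInducedCycle_iff : ∀ t ≤ j, ∀ F, IsInducedCycle (G.deleteEdges (S t).A) F ↔
    IsInducedCycle G F ∧ Disjoint F (S t).A
  mem_A : ∀ t ≤ j, ∀ q, q ∈ (S t).A ↔ ∃ s < t, x s = q
  cyclesThrough_eq : ∀ t < j, cyclesThrough (G.deleteEdges (S t).A) (x t) = {D t}
  c_eq : ∀ t ≤ j, ∀ q, (S t).c q =
    ∑ s ∈ Finset.range t, if q ∈ D s \ {x s} then (S s).c (x s) + 1 else 0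

lemma IsAlgRun.exists_isEliminationRun [Finite V] {G : SimpleGraph V} {j : ℕ} {S : ℕ → AlgState V}
    {x : ℕ → Sym2 V} (h : IsAlgRun G j S x) : ∃ D, IsEliminationRun G j S x D := by
  classical
  obtain ⟨h0, hstep⟩ := h
  have hinv : ∀ t ≤ j, (S t).Invariant G := by
    intro t
    induction t with
    | zero => exact fun _ => h0 ▸ AlgState.invariant_init G
    | succ t ih => exact fun ht => ((ih (by lia)).step (hstep t (by lia))).1
  have hD : ∀ t, ∃ C, t < j → cyclesThrough (G.deleteEdges (S t).A) (x t) = {C} ∧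
      S (t + 1) = (S t).update (x t) C := by
    intro t
    by_cases ht : t < j
    · obtain ⟨C, hC⟩ := ((hinv t ht.le).step (hstep t ht)).2
      exact ⟨C, fun _ => hC⟩
    · exact ⟨∅, fun h => absurd h ht⟩
  choose D hD using hD
  refine ⟨D, fun t ht => (hinv t ht).subset, fun t ht => (hinv t ht).isInducedCycle_iff, ?_,
    fun t ht => (hD t ht).1, ?_⟩
  · intro t
    induction t with
    | zero => intro _ q; simp [h0, AlgState.init]
    | succ t ih =>
      intro ht q
      rw [(hD t ht).2]
      change q ∈ (S t).A ∪ {x t} ↔ _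
      rw [Set.mem_union, ih (by lia), Set.mem_singleton_iff]
      constructor
      · rintro (⟨s, hs, rfl⟩ | rfl)
        · exact ⟨s, by lia, rfl⟩
        · exact ⟨t, by lia, rfl⟩
      · rintro ⟨s, hs, rfl⟩
        rcases Nat.lt_succ_iff_lt_or_eq.1 hs with h | rfl
        · exact .inl ⟨s, h, rfl⟩
        · exact .inr rfl
  · intro t
    induction t with
    | zero => intro _ q; simp [h0, AlgState.init]
    | succ t ih =>
      intro ht q
      rw [(hD t ht).2, Finset.sum_range_succ, ← ih (by lia)]
      change (if q ∈ D t \ {x t} then (S t).c q + (S t).c (x t) + 1 else (S t).c q) = _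
      split_ifs <;> lia

section Run

variable {G : SimpleGraph V} {j : ℕ} {S : ℕ → AlgState V} {x : ℕ → Sym2 V} {D : ℕ → Set (Sym2 V)}

lemma IsEliminationRun.D_mem (h : IsEliminationRun G j S x D) {t : ℕ} (ht : t < j) :
    D t ∈ cyclesThrough (G.deleteEdges (S t).A) (x t) := by
  rw [h.cyclesThrough_eq t ht]; rfl

lemma IsEliminationRun.A_mono (h : IsEliminationRun G j S x D) {s t : ℕ} (hst : s ≤ t)
    (ht : t ≤ j) : (S s).A ⊆ (S t).A := by
  intro q hq
  rw [h.mem_A s (hst.trans ht)] at hq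
  obtain ⟨r, hr, rfl⟩ := hq
  exact (h.mem_A t ht _).2 ⟨r, hr.trans_le hst, rfl⟩

lemma IsEliminationRun.isProcessedIn_iff (h : IsEliminationRun G j S x D) {t : ℕ} (ht : t < j)
    {F : Set (Sym2 V)} : IsProcessedIn G S x t F ↔ F = D t := by
  rw [IsProcessedIn, h.cyclesThrough_eq t ht, Set.mem_singleton_iff]

/-- An induced cycle that has lost an edge has been processed in exactly one iteration. -/
lemma IsEliminationRun.existsUnique_processed (h : IsEliminationRun G j S x D) {t : ℕ} (ht : t ≤ j)
    {F : Set (Sym2 V)} (hF : IsInducedCycle G F) (hFA : ¬ Disjoint F (S t).A) :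
    ∃! s, s < t ∧ IsProcessedIn G S x s F := by
  classical
  have hex : ∃ s, x s ∈ F ∧ s < t := by
    obtain ⟨q, hqF, hqA⟩ := Set.not_disjoint_iff.1 hFA
    obtain ⟨s, hs, rfl⟩ := (h.mem_A t ht q).1 hqA
    exact ⟨s, hqF, hs⟩
  have hlt : ∀ s s', s < s' → s' < t → IsProcessedIn G S x s F → ¬ IsProcessedIn G S x s' F := by
    intro s s' hss hs' h1 h2
    exact Set.disjoint_left.1 ((h.isInducedCycle_iff s' (by lia) F).1 h2.1).2 h1.2
      ((h.mem_A s' (by lia) _).2 ⟨s, hss, rfl⟩)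
  have hs := Nat.find_spec hex
  have hfp : IsProcessedIn G S x (Nat.find hex) F := by
    refine ⟨(h.isInducedCycle_iff _ (by lia) F).2 ⟨hF, Set.disjoint_left.2 ?_⟩, hs.1⟩
    intro q hqF hqA
    obtain ⟨r, hr, rfl⟩ := (h.mem_A _ (by lia) q).1 hqA
    exact Nat.find_min hex hr ⟨hqF, by lia⟩
  refine ⟨Nat.find hex, ⟨hs.2, hfp⟩, ?_⟩
  · rintro s ⟨hst, hsp⟩
    rcases lt_trichotomy s (Nat.find hex) with h' | h' | h'
    · exact absurd hfp (hlt _ _ h' hs.2 hsp)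
    · exact h'
    · exact absurd hsp (hlt _ _ h' hst hfp)

/-- As long as `e` has not been deleted, the part of `G` across `e` from `C` remains connected:
each edge deleted from it lies on an induced cycle of that part. -/
lemma IsEliminationRun.reachable_avoid_side (h : IsEliminationRun G j S x D)
    (hG : IsEdgeSeparated G Set.univ) {e : Sym2 V} {C : Set (Sym2 V)} (he : e ∈ G.edgeSet)
    {t : ℕ} (ht : t ≤ j) (het : e ∉ (S t).A) {a b : V} (ha : a ∉ side G e C)
    (hb : b ∉ side G e C) :
    (avoid (G.deleteEdges (S t).A) (side G e C)).Reachable a b := by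
  induction t generalizing a b with
  | zero =>
    have : (S 0).A = ∅ := by
      ext q
      simp [h.mem_A 0 ht]
    rw [this, deleteEdges_empty]
    exact hG.reachable_avoid_side he ha hb
  | succ t ih =>
    have htj : t < j := ht
    refine reachable_of_adj ?_ (ih htj.le (fun h' => het (h.A_mono t.le_succ ht h')) ha hb)
    intro y z hyz
    have hdel : (avoid (G.deleteEdges (S t).A) (side G e C)).deleteEdges {x t} ≤
        avoid (G.deleteEdges (S (t + 1)).A) (side G e C) := by
      intro u v huv
      rw [deleteEdges_adj] at huv
      refine ⟨deleteEdges_adj.2 ⟨(deleteEdges_adj.1 huv.1.1).1, fun h' => ?_⟩, huv.1.2⟩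
      obtain ⟨s, hs, hsx⟩ := (h.mem_A _ ht _).1 h'
      rcases Nat.lt_succ_iff_lt_or_eq.1 hs with h1 | rfl
      · exact (deleteEdges_adj.1 huv.1.1).2 ((h.mem_A t htj.le _).2 ⟨s, h1, hsx⟩)
      · exact huv.2 hsx.symm
    by_cases hx : s(y, z) = x t
    · refine Reachable.mono hdel ?_
      rw [← hx]
      have hD := h.D_mem htj
      have hDG := ((h.isInducedCycle_iff t htj.le _).1 hD.1).1
      -- the deleted edge is not `e`, so it has an end across `e` from `C`, and so has its cycle
      have hDs : ∀ w ∈ verts (D t), w ∉ side G e C := by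
        intro w hw hws
        have hne : e ≠ s(y, z) := by
          rintro rfl
          exact het ((h.mem_A _ ht _).2 ⟨t, t.lt_succ_self, hx.symm⟩)
        obtain ⟨v, hv, hve⟩ := exists_mem_notMem_of_ne (show s(y, z) ∈ G.edgeSet from
          (deleteEdges_adj.1 hyz.1).1) hne.symm
        have := hDG.mem_side he hw hws ⟨_, hD.2, by rwa [← hx]⟩ hve
        rcases Sym2.mem_iff.1 hv with rfl | rfl
        · exact hyz.2.1 this
        · exact hyz.2.2 this
      obtain ⟨u, c, hc, -, hcD⟩ := hD.1
      have hsub : ∀ e' ∈ c.edges, e' ∈ (avoid (G.deleteEdges (S t).A) (side G e C)).edgeSet := by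
        intro e' he'
        have he'D : e' ∈ D t := hcD ▸ he'
        induction e' with
        | _ v w =>
          exact ⟨c.adj_of_mem_edges he', hDs v ⟨_, he'D, Sym2.mem_mk_left v w⟩,
            hDs w ⟨_, he'D, Sym2.mem_mk_right v w⟩⟩
      refine (adj_and_reachable_delete_edges_iff_exists_cycle.2
        ⟨u, c.transfer _ hsub, hc.transfer hsub, ?_⟩).2
      have := hD.2
      rw [← hcD, ← hx] at this
      simpa using this
    · exact Adj.reachable (hdel (deleteEdges_adj.2 ⟨hyz, hx⟩))

end Run

/-! ### The recursion for supports and costs -/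

section Recursion

variable {G : SimpleGraph V} {j : ℕ} {S : ℕ → AlgState V} {x : ℕ → Sym2 V} {D : ℕ → Set (Sym2 V)}

/-- The cut that `e` and its support form in the part of `G` across `e` from `C` is the union of
`{e}` and of the corresponding cuts at the destructive edges of the processed induced cycles
through `e`. It is characterized by meeting the induced cycles in this part evenly, a property
that passes from the smaller cuts to the union. -/
lemma IsEliminationRun.Sup_eq_iUnion [Finite V] (h : IsEliminationRun G j S x D)
    (hG : IsEdgeSeparated G Set.univ) {t : ℕ} (ht : t ≤ j) {e : Sym2 V} {C : Set (Sym2 V)}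
    (hC : cyclesThrough (G.deleteEdges (S t).A) e = {C}) {ι : Type*} {F : ι → Set (Sym2 V)}
    (hinj : Function.Injective F) (hF : Set.range F = cyclesThrough G e \ {C}) {f : ι → ℕ}
    (hf : ∀ i, f i < t ∧ IsProcessedIn G S x (f i) (F i))
    (heven : ∀ i F', IsInducedCycle G F' → verts F' ⊆ (side G (x (f i)) (F i))ᶜ →
      Even (F' ∩ insert (x (f i)) (Sup G (S (f i)).A (x (f i)))).ncard) :
    Sup G (S t).A e = ⋃ i, insert (x (f i)) (Sup G (S (f i)).A (x (f i))) ∧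
      Pairwise (fun i i' => Disjoint (insert (x (f i)) (Sup G (S (f i)).A (x (f i))))
        (insert (x (f i')) (Sup G (S (f i')).A (x (f i'))))) ∧
      ∀ F', IsInducedCycle G F' → verts F' ⊆ (side G e C)ᶜ →
        Even (F' ∩ insert e (Sup G (S t).A e)).ncard := by
  have hCe : C ∈ cyclesThrough (G.deleteEdges (S t).A) e := by rw [hC]; rfl
  have heA := notMem_of_mem_cyclesThrough hCe
  have hCG := ((h.isInducedCycle_iff t ht C).1 hCe.1).1
  have heG := hCG.subset_edgeSet hCe.2
  have hFi : ∀ i, F i ∈ cyclesThrough G e ∧ F i ≠ C := fun i => by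
    have : F i ∈ cyclesThrough G e \ {C} := hF ▸ Set.mem_range_self i
    exact this
  set K : ι → Set (Sym2 V) := fun i => insert (x (f i)) (Sup G (S (f i)).A (x (f i))) with hKdef
  have hKA : ∀ i, K i ⊆ (S t).A := by
    rintro i q (rfl | hq)
    · exact (h.mem_A t ht _).2 ⟨f i, (hf i).1, rfl⟩
    · exact h.A_mono (hf i).1.le ht hq.1
  have hKe : ∀ i, e ∉ K i := fun i hi => heA (hKA i hi)
  have hxe : ∀ i, x (f i) ≠ e := fun i hi => hKe i (hi ▸ Set.mem_insert _ _)
  -- `K i` lies across the edge `x (f i)` from `F i`, so it lies on the side of `F i` at `e`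
  have hKs : ∀ i, ∀ q ∈ K i, ∀ w ∈ q, w ∉ side G (x (f i)) (F i) := by
    rintro i q (rfl | hq) w hw hws
    · exact hws.1 hw
    · have hfj : f i < j := (hf i).1.trans_le ht
      obtain ⟨u, Z, hZ, -, hqZ, -, hZs⟩ := exists_isCycle_of_mem_Sup hG (h.subset _ hfj.le)
        (hf i).2 (hFi i).1.1 hq
      exact hZs w ((mem_verts_edgeSet hZ).1 ⟨q, hqZ, hw⟩) hws
  have hKs' : ∀ i, ∀ q ∈ K i, ∀ w ∈ q, w ∉ e → w ∈ side G e (F i) := by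
    intro i q hq w hw hwe
    by_contra hws
    exact hKs i q hq w hw (hG.mem_side_of_notMem_side (hFi i).1 (hf i).2.2 (hxe i) hws hwe)
  have hsides : ∀ i i' w, w ∈ side G e (F i) → w ∈ side G e (F i') → i = i' := fun i i' w h1 h2 =>
    hinj (hG.eq_of_mem_side_of_mem_side (hFi i').1 (hFi i).1 h2 h1)
  have hvert : ∀ i, ∀ q ∈ K i, ∃ w ∈ q, w ∉ e := fun i q hq =>
    exists_mem_notMem_of_ne (h.subset t ht (hKA i hq)) fun hqe => hKe i (hqe ▸ hq)
  have hdisj : ∀ i i' q, q ∈ K i → q ∈ K i' → i = i' := by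
    intro i i' q hq hq'
    obtain ⟨w, hw, hwe⟩ := hvert i q hq
    exact hsides i i' w (hKs' i q hq w hw hwe) (hKs' i' q hq' w hw hwe)
  have hT : ∀ F', IsInducedCycle G F' → verts F' ⊆ (side G e C)ᶜ →
      Even (F' ∩ insert e (⋃ i, K i)).ncard := by
    intro F' hF' hF's
    by_cases heF : e ∈ F'
    · -- `F'` is one of the induced cycles `F i` and contains only `e` and `x (f i)`
      have hne : F' ≠ C := by
        rintro rfl
        obtain ⟨w, hw, hwe⟩ := hF'.exists_vert_notMem e
        exact hF's hw (mem_side_of_mem_verts hw hwe)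
      obtain ⟨i, rfl⟩ : F' ∈ Set.range F := by
        rw [hF]
        exact ⟨⟨hF', heF⟩, hne⟩
      have : F i ∩ insert e (⋃ i, K i) = {e, x (f i)} := by
        ext q
        constructor
        · rintro ⟨hq, rfl | hqK⟩
          · exact .inl rfl
          · obtain ⟨l, hl⟩ := Set.mem_iUnion.1 hqK
            obtain ⟨w, hw, hwe⟩ := hvert l q hl
            obtain rfl := hsides i l w (mem_side_of_mem_verts ⟨q, hq, hw⟩ hwe)
              (hKs' l q hl w hw hwe)
            right
            by_contra hqx
            obtain ⟨v, hv, hvx⟩ := exists_mem_notMem_of_ne (hF'.subset_edgeSet hq) hqx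
            exact hKs i q hl v hv (mem_side_of_mem_verts ⟨q, hq, hv⟩ hvx)
        · rintro (rfl | rfl)
          · exact ⟨heF, .inl rfl⟩
          · exact ⟨(hf i).2.2, .inr (Set.mem_iUnion.2 ⟨i, .inl rfl⟩)⟩
      rw [this, Set.ncard_pair (hxe i).symm]
      exact even_two
    · by_cases hempty : ∃ i, ∃ q ∈ F', q ∈ K i
      · -- `F'` lies on one side of `e`, so it meets no other `K l` besides `K i`
        obtain ⟨i, q, hqF, hqK⟩ := hempty
        have : F' ∩ insert e (⋃ i, K i) = F' ∩ K i := by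
          ext q'
          constructor
          · rintro ⟨hq', rfl | hqK'⟩
            · exact absurd hq' heF
            · obtain ⟨l, hl⟩ := Set.mem_iUnion.1 hqK'
              obtain ⟨w, hw, hwe⟩ := hvert i q hqK
              obtain ⟨w', hw', hwe'⟩ := hvert l q' hl
              obtain rfl := hsides i l w' (hF'.mem_side heG ⟨q, hqF, hw⟩
                (hKs' i q hqK w hw hwe) ⟨q', hq', hw'⟩ hwe') (hKs' l q' hl w' hw' hwe')
              exact ⟨hq', hl⟩
          · exact fun hq' => ⟨hq'.1, .inr (Set.mem_iUnion.2 ⟨i, hq'.2⟩)⟩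
        rw [this]
        refine heven i F' hF' fun z hz hzs => ?_
        have hxG := (hFi i).1.1.subset_edgeSet (hf i).2.2
        by_cases hqx : q = x (f i)
        · have := hG.eq_of_mem_side ⟨(hFi i).1.1, (hf i).2.2⟩ ⟨hF', hqx ▸ hqF⟩ hz hzs
          exact heF (this ▸ (hFi i).1.2)
        · obtain ⟨v, hv, hvx⟩ := exists_mem_notMem_of_ne (hF'.subset_edgeSet hqF) hqx
          exact hKs i q hqK v hv (hF'.mem_side hxG hz hzs ⟨q, hqF, hv⟩ hvx)
      · have : F' ∩ insert e (⋃ i, K i) = ∅ := by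
          rw [Set.eq_empty_iff_forall_notMem]
          rintro q ⟨hq, rfl | hqK⟩
          · exact heF hq
          · obtain ⟨i, hi⟩ := Set.mem_iUnion.1 hqK
            exact hempty ⟨i, q, hq, hi⟩
        rw [this, Set.ncard_empty]
        exact Even.zero
  have hSup : Sup G (S t).A e = ⋃ i, K i := by
    refine Sup_eq_of_even hG (h.subset t ht) hCe hCG (fun F hF => by rwa [hC] at hF)
      (fun a b ha hb => h.reachable_avoid_side hG heG ht heA ha hb)
      (Set.iUnion_subset hKA) ?_ hT
    intro q hq w hw hws
    obtain ⟨i, hi⟩ := Set.mem_iUnion.1 hq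
    exact (hFi i).2 (hG.eq_of_mem_side_of_mem_side ⟨hCG, hCe.2⟩ (hFi i).1 hws
      (hKs' i q hi w hw hws.1))
  refine ⟨hSup, fun i i' hne => Set.disjoint_left.2 fun q hq hq' => hne (hdisj i i' q hq hq'), ?_⟩
  rw [hSup]
  exact hT

lemma IsEliminationRun.notMem_Sup (h : IsEliminationRun G j S x D) {t : ℕ} (ht : t < j) :
    x t ∉ Sup G (S t).A (x t) := fun hx => notMem_of_mem_cyclesThrough (h.D_mem ht) hx.1

lemma IsEliminationRun.c_eq_sum (h : IsEliminationRun G j S x D) {t : ℕ} (ht : t ≤ j) {e : Sym2 V}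
    {C : Set (Sym2 V)} (hC : C ∈ cyclesThrough (G.deleteEdges (S t).A) e) {ι : Type*} [Fintype ι]
    {F : ι → Set (Sym2 V)} (hinj : Function.Injective F)
    (hF : Set.range F = cyclesThrough G e \ {C}) {f : ι → ℕ}
    (hf : ∀ i, f i < t ∧ IsProcessedIn G S x (f i) (F i)) :
    (S t).c e = ∑ i, ((S (f i)).c (x (f i)) + 1) := by
  classical
  have heA := notMem_of_mem_cyclesThrough hC
  have hFD : ∀ i, F i = D (f i) := fun i =>
    (h.isProcessedIn_iff ((hf i).1.trans_le ht)).1 (hf i).2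
  have hfinj : Function.Injective f := fun i i' hii => hinj (by rw [hFD, hFD, hii])
  have hset : (Finset.range t).filter (fun s => e ∈ D s \ {x s}) = Finset.univ.image f := by
    ext s
    simp only [Finset.mem_filter, Finset.mem_range, Finset.mem_image, Finset.mem_univ, true_and]
    constructor
    · rintro ⟨hst, heD, -⟩
      have hD := h.D_mem (hst.trans_le ht)
      have hDG := ((h.isInducedCycle_iff s (by lia) _).1 hD.1).1
      have hne : D s ≠ C := by
        rintro hDC
        refine Set.disjoint_left.1 ((h.isInducedCycle_iff t ht C).1 hC.1).2 (hDC ▸ hD.2) ?_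
        exact (h.mem_A t ht _).2 ⟨s, hst, rfl⟩
      have hmem : D s ∈ Set.range F := by
        rw [hF]
        exact ⟨⟨hDG, heD⟩, hne⟩
      obtain ⟨i, hi⟩ := hmem
      refine ⟨i, (h.existsUnique_processed ht hDG (Set.not_disjoint_iff.2
        ⟨x s, hD.2, (h.mem_A t ht _).2 ⟨s, hst, rfl⟩⟩)).unique ⟨(hf i).1, hi ▸ (hf i).2⟩ ⟨hst, hD⟩⟩
    · rintro ⟨i, rfl⟩
      have : F i ∈ cyclesThrough G e \ {C} := hF ▸ Set.mem_range_self i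
      refine ⟨(hf i).1, hFD i ▸ this.1.2, ?_⟩
      rintro rfl
      exact heA ((h.mem_A t ht _).2 ⟨f i, (hf i).1, rfl⟩)
  rw [h.c_eq t ht, ← Finset.sum_filter, hset, Finset.sum_image hfinj.injOn]

lemma IsEliminationRun.cost_eq_sum [Finite V] (h : IsEliminationRun G j S x D) {t : ℕ}
    (ht : t ≤ j) {e : Sym2 V} {ι : Type*} [Fintype ι] {f : ι → ℕ} (hf : ∀ i, f i < t)
    (hSup : Sup G (S t).A e = ⋃ i, insert (x (f i)) (Sup G (S (f i)).A (x (f i))))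
    (hdisj : Pairwise (fun i i' => Disjoint (insert (x (f i)) (Sup G (S (f i)).A (x (f i))))
      (insert (x (f i')) (Sup G (S (f i')).A (x (f i')))))) :
    cost G (S t).A e = ∑ i, (cost G (S (f i)).A (x (f i)) + 1) := by
  rw [cost, hSup, Set.ncard_iUnion_of_finite (fun i => Set.toFinite _) hdisj,
    finsum_eq_sum_of_fintype]
  exact Finset.sum_congr rfl fun i _ =>
    Set.ncard_insert_of_notMem (h.notMem_Sup ((hf i).trans_le ht)) (Set.toFinite _)

lemma IsEliminationRun.not_disjoint_of_ne (h : IsEliminationRun G j S x D) {t : ℕ} (ht : t ≤ j)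
    {e : Sym2 V} {C F : Set (Sym2 V)} (hC : cyclesThrough (G.deleteEdges (S t).A) e = {C})
    (hF : F ∈ cyclesThrough G e \ {C}) : ¬ Disjoint F (S t).A := fun hd =>
  hF.2 (hC ▸ (show F ∈ cyclesThrough (G.deleteEdges (S t).A) e from
    ⟨(h.isInducedCycle_iff t ht F).2 ⟨hF.1.1, hd⟩, hF.1.2⟩))

/-- By induction on the number of iterations, the support of each edge `e` of the heap forms with
`e` a cut of the part of `G` across `e`, and the stored value is the cost of `e`. -/
lemma IsEliminationRun.even_and_c_eq_cost [Finite V] (h : IsEliminationRun G j S x D)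
    (hG : IsEdgeSeparated G Set.univ) {t : ℕ} (ht : t ≤ j) {e : Sym2 V} {C : Set (Sym2 V)}
    (hC : cyclesThrough (G.deleteEdges (S t).A) e = {C}) :
    (∀ F', IsInducedCycle G F' → verts F' ⊆ (side G e C)ᶜ →
      Even (F' ∩ insert e (Sup G (S t).A e)).ncard) ∧ (S t).c e = cost G (S t).A e := by
  induction t using Nat.strong_induction_on generalizing e C with
  | _ t ih =>
  have hCe : C ∈ cyclesThrough (G.deleteEdges (S t).A) e := by rw [hC]; rfl
  let F : ↥(cyclesThrough G e \ {C}) → Set (Sym2 V) := Subtype.val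
  have : Fintype ↥(cyclesThrough G e \ {C}) := Fintype.ofFinite _
  have hF : Set.range F = cyclesThrough G e \ {C} := Subtype.range_coe
  choose f hf using fun i : ↥(cyclesThrough G e \ {C}) => (h.existsUnique_processed ht i.2.1.1
    (h.not_disjoint_of_ne ht hC i.2)).exists
  have hfj : ∀ i, f i < j := fun i => (hf i).1.trans_le ht
  have hFD : ∀ i, F i = D (f i) := fun i => (h.isProcessedIn_iff (hfj i)).1 (hf i).2
  have ih' := fun i => ih (f i) (hf i).1 (hfj i).le (hFD i ▸ h.cyclesThrough_eq (f i) (hfj i))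
  obtain ⟨hSup, hdisj, heven⟩ := h.Sup_eq_iUnion hG ht hC Subtype.val_injective hF hf
    fun i => (ih' i).1
  refine ⟨heven, ?_⟩
  rw [h.c_eq_sum ht hCe Subtype.val_injective hF hf,
    h.cost_eq_sum ht (fun i => (hf i).1) hSup hdisj]
  exact Finset.sum_congr rfl fun i _ => by rw [(ih' i).2]

end Recursion

end PolygonalTwoTree

end

theorem mainTheorem5 {V : Type*} [Fintype V] (G : SimpleGraph V)
    (hG : PolygonalTwoTree.IsPolygonal2Tree G)
    (j : ℕ) (S : ℕ → PolygonalTwoTree.AlgState V) (x : ℕ → Sym2 V)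
    (hrun : PolygonalTwoTree.IsAlgRun G j S x)
    (e : Sym2 V) (he : e ∈ PolygonalTwoTree.bound G (S j).A)
    (hint : PolygonalTwoTree.IsInternalEdge G e) :
    -- there is exactly one induced cycle of `G - A_j` through `e`, and it is external
    (∃! C : Set (Sym2 V), C ∈ PolygonalTwoTree.cyclesThrough (G.deleteEdges (S j).A) e) ∧
    ∀ C : Set (Sym2 V), C ∈ PolygonalTwoTree.cyclesThrough (G.deleteEdges (S j).A) e →
      PolygonalTwoTree.IsExternalInducedCycle (G.deleteEdges (S j).A) C ∧
      -- `D 0, …, D (k - 1)` are the other induced cycles of `G` through `e`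
      ∀ (k : ℕ) (D : Fin k → Set (Sym2 V)), Function.Injective D →
        Set.range D = PolygonalTwoTree.cyclesThrough G e \ {C} →
        -- each of them has been processed in exactly one of the first `j` iterations
        (∀ i, ∃! t, t < j ∧ PolygonalTwoTree.IsProcessedIn G S x t (D i)) ∧
        -- `D i` is processed in iteration `f i + 1`, with destructive edge `x (f i)`
        ∀ f : Fin k → ℕ,
          (∀ i, f i < j ∧ PolygonalTwoTree.IsProcessedIn G S x (f i) (D i)) →
          (∀ i, x (f i) ∈ PolygonalTwoTree.bound G (S (f i)).A) ∧
          -- the support of `e` is the disjoint union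
          PolygonalTwoTree.Sup G (S j).A e =
            (⋃ i, PolygonalTwoTree.Sup G (S (f i)).A (x (f i))) ∪ Set.range (fun i => x (f i)) ∧
          (∀ i i', i ≠ i' → Disjoint (PolygonalTwoTree.Sup G (S (f i)).A (x (f i)))
            (PolygonalTwoTree.Sup G (S (f i')).A (x (f i')))) ∧
          (∀ i, Disjoint (PolygonalTwoTree.Sup G (S (f i)).A (x (f i)))
            (Set.range (fun i' => x (f i')))) ∧
          Function.Injective (fun i => x (f i)) ∧
          -- the costs, and the value stored by the algorithm
          PolygonalTwoTree.cost G (S j).A e =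
            (∑ i, PolygonalTwoTree.cost G (S (f i)).A (x (f i))) + k ∧
          (S j).c e = PolygonalTwoTree.cost G (S j).A e := by
  obtain ⟨R, h⟩ := hrun.exists_isEliminationRun
  have hG := hG.isEdgeSeparated
  obtain ⟨C₀, hC₀⟩ := PolygonalTwoTree.mem_bound_iff.1 he
  refine ⟨⟨C₀, by rw [hC₀]; rfl, fun C hC => by rwa [hC₀] at hC⟩, fun C hC => ?_⟩
  have hCC : C = C₀ := by rwa [hC₀] at hC
  subst hCC
  refine ⟨⟨hC.1, e, hC.2, he.1⟩, fun k D hinj hD => ⟨fun i => ?_, fun f hf => ?_⟩⟩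
  · have hi : D i ∈ PolygonalTwoTree.cyclesThrough G e \ {C} := hD ▸ Set.mem_range_self i
    exact h.existsUnique_processed le_rfl hi.1.1 (h.not_disjoint_of_ne le_rfl hC₀ hi)
  have hFD : ∀ i, D i = R (f i) := fun i => (h.isProcessedIn_iff (hf i).1).1 (hf i).2
  have hthr := fun i => h.cyclesThrough_eq (f i) (hf i).1
  obtain ⟨hSup, hdisj, -⟩ := h.Sup_eq_iUnion hG le_rfl hC₀ hinj hD hf
    fun i => (h.even_and_c_eq_cost hG (hf i).1.le (hFD i ▸ hthr i)).1
  refine ⟨fun i => PolygonalTwoTree.mem_bound_iff.2 ⟨_, hthr i⟩, ?_, fun i i' hne =>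
    (hdisj hne).mono (Set.subset_insert _ _) (Set.subset_insert _ _), fun i => ?_, ?_, ?_,
    (h.even_and_c_eq_cost hG le_rfl hC₀).2⟩
  · rw [hSup]
    ext q
    simp only [Set.mem_iUnion, Set.mem_insert_iff, Set.mem_union, Set.mem_range, exists_or,
      eq_comm (a := q)]
    exact or_comm
  · rw [Set.disjoint_right]
    rintro _ ⟨i', rfl⟩ hx
    by_cases hii : i = i'
    · subst hii
      exact h.notMem_Sup (hf i).1 hx
    · exact Set.disjoint_left.1 (hdisj hii) (.inr hx) (.inl rfl)
  · intro i i' hii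
    by_contra hne
    exact Set.disjoint_left.1 (hdisj hne) (.inl rfl) (.inl hii)
  · rw [h.cost_eq_sum le_rfl (fun i => (hf i).1) hSup hdisj, Finset.sum_add_distrib]
    simp
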